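/- Let $n\ge 0$ and $k\ge 1$. A $k$-ary word is a word over $\{1,\dots,k\}$. A $k$-ary faro word is a word $u_1v_1u_2v_2\cdots$ obtained by interlacing two nondecreasing $k$-ary words $u,v$ with $0\le |u|-|v|\le 1$; let $\mathcal S_{n,k}$ be the set of those of length $n$. A pair of a word $w$ is a factor $w_iw_{i+1}$ with $w_i>w_{i+1}$, and a singleton is a letter $w_i$ that lies in no pair. A dispersed Dyck path is a lattice path with steps $U=(1,1)$, $D=(1,-1)$, $F=(1,0)$ that starts and ends on the $x$-axis, never goes below it, and has all its $F$ steps on it; let $\mathcal B_{N,m}$ be the set of those with $N$ steps and exactly $m$ peaks $UD$. For a faro word $w\in\mathcal S_{n,k}$ put $$f(w)=F^{s(1)}\,U^{1+q(1)}D^{1+p(2)}F^{s(2)}\,U^{1+q(2)}D^{1+p(3)}F^{s(3)}\cdots U^{1+q(k-1)}D^{1+p(k)}F^{s(k)},$$ where $s(x)$ is the number of singletons of $w$ equal to $x$, $p(x)$ is the number of pairs $xy$ with $y<x$, and $q(x)$ is the number of pairs $yx$ with $y>x$. For a word $p$ of length three over $\{1,2,3\}$ let $\mathbf p(w)$ be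 the number of indices $i$ such that the consecutive factor $w_iw_{i+1}w_{i+2}$ is order-isomorphic to $p$. For a word $X$ over $\{U,D,F\}$ let $\mathbf X(P)$ be the number of occurrences of $X$ in the path $P$ as a factor of consecutive steps; $\mathbf{Y(UD)^*Z}=\sum_{i\ge 0}\mathbf{Y(UD)^iZ}$ and $\mathbf{Y(UD)^+Z}=\sum_{i\ge 1}\mathbf{Y(UD)^iZ}$, with one independent summation index for each $*$ or $+$ when several occur. For statistics $\mathbf s$ on words and $\mathbf t$ on paths, $f(\mathbf s)=\mathbf t$ means $\mathbf s(w)=\mathbf t(f(w))$ for every $w\in\mathcal S_{n,k}$. Then $f$ is a bijection from $\mathcal S_{n,k}$ onto $\mathcal B_{n+2(k-1),k-1}$, and \begin{align*} f(\mathbf{111}) &= \mathbf{FFF},\\ f(\mathbf{112}) &= \mathbf{FF(UD)^+F}+\mathbf{FF(UD)^*UU},\\ f(\mathbf{122}) &= \mathbf{F(UD)^+FF}+\mathbf{DD(UD)^*FF},\\ f(\mathbf{121}) &= \mathbf{FUU}+\mathbf{UUU},\\ f(\mathbf{212}) &= \mathbf{DDF}+\mathbf{DDD},\\ f(\mathbf{132})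 &= \mathbf{F(UD)^+UU}+\mathbf{U(UD)^+UU}+\mathbf{DD(UD)^*UU},\\ f(\mathbf{213}) &= \mathbf{DD(UD)^+F}+\mathbf{DD(UD)^+D}+\mathbf{DD(UD)^*UU},\\ f(\mathbf{123}) &= \mathbf{DD(UD)^*F(UD)^*UU}+\mathbf{DD(UD)^*F(UD)^+F}+\mathbf{F(UD)^+F(UD)^*UU}+\mathbf{F(UD)^+F(UD)^+F},\\ f(\mathbf{211}) &= f(\mathbf{221})=f(\mathbf{231})=f(\mathbf{312})=f(\mathbf{321})=\mathbf 0 . \end{align*} -/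

import Mathlib

namespace Faro

/-! ### Words, consecutive patterns, faro words -/

/-- The interlacing `u₁ v₁ u₂ v₂ u₃ v₃ …` of two words. -/
def faroShuffle : List ℕ → List ℕ → List ℕ
  | [], v => v
  | u, [] => u
  | a :: u, b :: v => a :: b :: faroShuffle u v

/-- A `k`-ary word: all letters lie in `[1, k]`. -/
def IsWord (k : ℕ) (w : List ℕ) : Prop := ∀ x ∈ w, 1 ≤ x ∧ x ≤ k

/-- The set of `k`-ary faro words of length `n`: the faro shuffles of two nondecreasing `k`-ary
words `u`, `v` with `0 ≤ |u| - |v| ≤ 1`. -/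
def faroWords (n k : ℕ) : Set (List ℕ) :=
  {w | w.length = n ∧ ∃ u v : List ℕ, IsWord k u ∧ IsWord k v ∧
    u.Pairwise (· ≤ ·) ∧ v.Pairwise (· ≤ ·) ∧
    v.length ≤ u.length ∧ u.length ≤ v.length + 1 ∧ w = faroShuffle u v}

/-- Two words are order-isomorphic: same length, and their letters compare in the same way. -/
def OrderIsomorphic (p q : List ℕ) : Prop :=
  p.length = q.length ∧ ∀ i < p.length, ∀ j < p.length,
    (p.getD i 0 < p.getD j 0 ↔ q.getD i 0 < q.getD j 0)

instance (p q : List ℕ) : Decidable (OrderIsomorphic p q) := by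
  unfold OrderIsomorphic; infer_instance

/-- The number of occurrences of the consecutive pattern `p` in the word `w`: the number of
starting positions (that is, of tails of `w`) at which the factor of length `|p|` is
order-isomorphic to `p`. -/
def wordStat (p w : List ℕ) : ℕ :=
  w.tails.countP fun t => decide (OrderIsomorphic p (t.take p.length))

/-! ### Blocks of a word -/

/-- The letters of `w` at the positions `i`, `i + 1` (counted from `0`) form a pair, that is,
a descent. -/
def IsPairAt (w : List ℕ) (i : ℕ) : Prop :=
  i + 1 < w.length ∧ w.getD (i + 1) 0 < w.getD i 0

instance (w : List ℕ) (i : ℕ) : Decidable (IsPairAt w i) := by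
  unfold IsPairAt; infer_instance

/-- The letter of `w` at position `i` belongs to no pair of `w`. -/
def IsSingletonAt (w : List ℕ) (i : ℕ) : Prop :=
  i < w.length ∧ ¬ IsPairAt w i ∧ ¬ (0 < i ∧ IsPairAt w (i - 1))

instance (w : List ℕ) (i : ℕ) : Decidable (IsSingletonAt w i) := by
  unfold IsSingletonAt; infer_instance

/-- The number of pairs `x y`, `y < x`, in `w`. -/
def pairsWithFirst (w : List ℕ) (x : ℕ) : ℕ :=
  ((Finset.range w.length).filter fun i => IsPairAt w i ∧ w.getD i 0 = x).card

/-- The number of pairs `y x`, `y > x`, in `w`. -/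
def pairsWithSecond (w : List ℕ) (x : ℕ) : ℕ :=
  ((Finset.range w.length).filter fun i => IsPairAt w i ∧ w.getD (i + 1) 0 = x).card

/-- The number of occurrences of the singleton `x` in `w`. -/
def singletons (w : List ℕ) (x : ℕ) : ℕ :=
  ((Finset.range w.length).filter fun i => IsSingletonAt w i ∧ w.getD i 0 = x).card

/-! ### Lattice paths -/

/-- Up, down and level steps. -/
inductive Step
  | U
  | D
  | F
  deriving DecidableEq

/-- The height change of a step. -/
def Step.rise : Step → ℤ
  | .U => 1
  | .D => -1
  | .F => 0

/-- The final height of a path started at height `0`. -/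
def height (P : List Step) : ℤ := (P.map Step.rise).sum

/-- Dispersed Dyck paths: they end on the `x`-axis, never go below it, and have their level steps
on the `x`-axis. -/
def IsDispersedDyck (P : List Step) : Prop :=
  height P = 0 ∧ (∀ Q, Q <+: P → 0 ≤ height Q) ∧ (∀ Q, Q ++ [Step.F] <+: P → height Q = 0)

/-- The number of occurrences of `p` in the path `P` as a sequence of consecutive steps: the
number of starting positions (that is, of tails of `P`) at which `p` can be read. -/
def occ (p P : List Step) : ℕ := P.tails.countP fun t => p.isPrefixOf t

/-- A pattern longer than the path does not occur in it. -/
theorem occ_eq_zero_of_length_lt {p P : List Step} (h : P.length < p.length) : occ p P = 0 := by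
  unfold occ
  rw [List.countP_eq_zero]
  intro t ht hp
  have h1 := (List.isPrefixOf_iff_prefix.mp hp).length_le
  have h2 := ((List.mem_tails t P).mp ht).length_le
  omega

/-- The set of dispersed Dyck paths of length `N` with exactly `m` peaks `UD`. -/
def dispersedDyck (N m : ℕ) : Set (List Step) :=
  {P | P.length = N ∧ IsDispersedDyck P ∧ occ [Step.U, Step.D] P = m}

/-- The path `(UD)^k`. -/
def ud (k : ℕ) : List Step := (List.replicate k [Step.U, Step.D]).flatten

/-- For `s k = occ (Y ++ ud k ++ Z)`, this is the statistic `Y(UD)^*Z`, the sum over `k ≥ 0` of the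
statistics `Y(UD)^kZ`. Only `k ≤ |P|` can contribute, by `occ_eq_zero_of_length_lt`. -/
def starStat (s : ℕ → List Step → ℕ) (P : List Step) : ℕ :=
  ∑ k ∈ Finset.range (P.length + 1), s k P

/-- For `s k = occ (Y ++ ud k ++ Z)`, this is the statistic `Y(UD)^+Z`, the sum over `k ≥ 1` of the
statistics `Y(UD)^kZ`. -/
def plusStat (s : ℕ → List Step → ℕ) (P : List Step) : ℕ :=
  ∑ k ∈ Finset.Icc 1 P.length, s k P

/-! ### The map from faro words to paths -/

/-- The path `F^{s(1)} U^{1+q(1)} D^{1+p(2)} F^{s(2)} U^{1+q(2)} D^{1+p(3)} F^{s(3)} ⋯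
U^{1+q(k-1)} D^{1+p(k)} F^{s(k)}`, where `s(x)` is the number of singletons `x` in `w`, `p(x)` the
number of pairs `x y` with `y < x`, and `q(x)` the number of pairs `y x` with `y > x`. -/
def faroPath (k : ℕ) (w : List ℕ) : List Step :=
  List.replicate (singletons w 1) Step.F ++
    (List.range' 1 (k - 1)).flatMap fun x =>
      List.replicate (1 + pairsWithSecond w x) Step.U ++
        List.replicate (1 + pairsWithFirst w (x + 1)) Step.D ++
          List.replicate (singletons w (x + 1)) Step.F

end Faro

namespace Faro

/-! A word is a faro word exactly when letters two places apart are weakly increasing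
(`SkipSorted`). Such a word splits uniquely into blocks: each descent `b a` is coded by `(a, b)` and
each singleton `x` by `(x, x)`. The faro condition then says that the blocks increase weakly in the
product order on `ℕ × ℕ` (`exists_blocksWord_eq`, `skipSorted_blocksWord`). The exponents of the
path count the blocks `(x, x)`, the pairs with smaller letter `x` and the pairs with larger letter
`x` (`counts_blocksWord`).

For bijectivity, the height of the path at `F^{s(x)}` is the number of pairs with one letter below
and one letter above `x`. No such pair is comparable with `(x, x)`, so level steps occur only at
height zero. The path determines the multisets of smaller and of larger letters, and both
coordinates are sorted along the sequence, so it determines the blocks (`isBlocks_ext`). Conversely,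
up steps open pairs and down steps close them; monotonicity forces first-in-first-out matching
(`exists_blocks`).

For the statistics, both sides become the same sum over letters `x` of expressions in `s(x)`,
`q(x)`, `p(x)` and the truth values of "some letter is below `x`" and "some letter is above `x`". On
the word side each occurrence is charged to a cut between blocks, and the blocks are grouped by
larger or by smaller letter (`scan_eq_sum_of_max_segment`, `scan_eq_sum_of_min_segment`).

On the path side each occurrence is charged to a cut between steps, and the part left of the cut is
read backwards with `U` and `D` exchanged, so that both sides of the cut are treated alike. After
the leading peaks are stripped from a valid path, what remains is empty or starts with `F`, `D` or
`UU`. Hence the sums with `(UD)^*` and `(UD)^+` collapse to the single condition `riseInd`: the path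
begins with `U` and is not a power of `UD` (`plusInd_add_plusInd_add_starInd`). Next to `F^{s(x)}`
this condition says that some letter is below, respectively above, `x`, and `scan_runsPath` adds up
the contributions of the runs. -/

/-! ### Faro words as monotone sequences of blocks -/

/-- Letters two places apart are weakly increasing. -/
def SkipSorted : List ℕ → Prop
  | a :: b :: c :: t => a ≤ c ∧ SkipSorted (b :: c :: t)
  | _ => True

theorem SkipSorted.tail {a : ℕ} {w : List ℕ} (h : SkipSorted (a :: w)) : SkipSorted w := by
  match w, h with
  | [], _ => trivial
  | [_], _ => trivial
  | _ :: _ :: _, h => exact h.2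

/-- The definition consumes two letters at a time. Consuming one letter exchanges the two words, and
the condition `0 ≤ |u| - |v| ≤ 1` survives the exchange, so inductions can proceed letter by letter.
-/
theorem faroShuffle_cons (a : ℕ) (u v : List ℕ) :
    faroShuffle (a :: u) v = a :: faroShuffle v u := by
  induction u generalizing a v with
  | nil => cases v with
    | nil => simp [faroShuffle]
    | cons b v => simp [faroShuffle]
  | cons c u ih => cases v with
    | nil => simp [faroShuffle]
    | cons b v => rw [faroShuffle, ih c v, faroShuffle]

theorem mem_faroShuffle (x : ℕ) (u v : List ℕ) : x ∈ faroShuffle u v ↔ x ∈ u ∨ x ∈ v := by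
  induction u generalizing v with
  | nil => simp [faroShuffle]
  | cons a u ih =>
    cases v with
    | nil => simp [faroShuffle]
    | cons b v => simp [faroShuffle, ih]; tauto

theorem skipSorted_faroShuffle (n : ℕ) : ∀ u v : List ℕ, u.length + v.length = n →
    u.Pairwise (· ≤ ·) → v.Pairwise (· ≤ ·) → v.length ≤ u.length → u.length ≤ v.length + 1 →
    SkipSorted (faroShuffle u v) := by
  induction n with
  | zero =>
    intro u v h _ _ _ _
    have hu : u = [] := List.eq_nil_of_length_eq_zero (by omega)
    have hv : v = [] := List.eq_nil_of_length_eq_zero (by omega)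
    subst hu hv
    simp [faroShuffle, SkipSorted]
  | succ n ih =>
    intro u v h hu hv h1 h2
    cases u with
    | nil => simp at h h1; simp [h1] at h
    | cons a u =>
      simp only [List.length_cons] at h h1 h2
      have := ih v u (by omega) hv hu.tail (by omega) (by omega)
      rw [faroShuffle_cons]
      match v, u, this with
      | [], [], _ => simp [faroShuffle, SkipSorted]
      | [], c :: u, _ => simp at h2
      | [b], [], _ => simp [faroShuffle, SkipSorted]
      | b :: b' :: v, [], _ => simp at h1
      | b :: v, c :: u, this =>
        rw [faroShuffle] at this ⊢
        exact ⟨List.rel_of_pairwise_cons hu (by simp), this⟩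

/-- The two words are the subsequences at alternate positions; a new first letter joins the shorter
or equal one, which then becomes the first word. -/
theorem exists_faroShuffle_eq (w : List ℕ) (h : SkipSorted w) : ∃ u v : List ℕ,
    u.Pairwise (· ≤ ·) ∧ v.Pairwise (· ≤ ·) ∧ v.length ≤ u.length ∧ u.length ≤ v.length + 1 ∧
      w = faroShuffle u v := by
  induction w with
  | nil => exact ⟨[], [], by simp [faroShuffle]⟩
  | cons a w ih =>
    obtain ⟨u, v, hu, hv, h1, h2, rfl⟩ := ih h.tail
    refine ⟨a :: v, u, ?_, hu, by simp; omega, by simp; omega, (faroShuffle_cons _ _ _).symm⟩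
    cases v with
    | nil => simp
    | cons b v =>
      cases u with
      | nil => simp at h1
      | cons c u =>
        rw [faroShuffle] at h
        have hab : a ≤ b := h.1
        simp only [List.pairwise_cons] at hv ⊢
        refine ⟨fun y hy => ?_, hv⟩
        rcases List.mem_cons.1 hy with rfl | hy
        · exact hab
        · exact hab.trans (hv.1 y hy)

theorem mem_faroWords {n k : ℕ} {w : List ℕ} :
    w ∈ faroWords n k ↔ w.length = n ∧ IsWord k w ∧ SkipSorted w := by
  constructor
  · rintro ⟨h, u, v, h1, h2, h3, h4, h5, h6, rfl⟩
    refine ⟨h, fun x hx => ?_, skipSorted_faroShuffle _ u v rfl h3 h4 h5 h6⟩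
    rcases (mem_faroShuffle x u v).1 hx with hx | hx
    exacts [h1 x hx, h2 x hx]
  · rintro ⟨h, h1, h2⟩
    obtain ⟨u, v, hu, hv, h3, h4, rfl⟩ := exists_faroShuffle_eq w h2
    exact ⟨h, u, v, fun x hx => h1 x ((mem_faroShuffle x u v).2 (Or.inl hx)),
      fun x hx => h1 x ((mem_faroShuffle x u v).2 (Or.inr hx)), hu, hv, h3, h4, rfl⟩

/-- The block with smallest letter `B.1` and largest letter `B.2`: a singleton or a pair. -/
def blockWord (B : ℕ × ℕ) : List ℕ := if B.1 < B.2 then [B.2, B.1] else [B.1]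

/-- The word with a given sequence of blocks. -/
def blocksWord (L : List (ℕ × ℕ)) : List ℕ := L.flatMap blockWord

/-- Sequences of blocks of faro words. -/
def IsBlocks (L : List (ℕ × ℕ)) : Prop := (∀ B ∈ L, B.1 ≤ B.2) ∧ L.Pairwise (· ≤ ·)

theorem isBlocks_cons {B : ℕ × ℕ} {L : List (ℕ × ℕ)} :
    IsBlocks (B :: L) ↔ B.1 ≤ B.2 ∧ (∀ C ∈ L, B ≤ C) ∧ IsBlocks L := by
  simp only [IsBlocks, List.mem_cons, forall_eq_or_imp, List.pairwise_cons]
  tauto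

theorem isBlocks_cons_cons {B C : ℕ × ℕ} {L : List (ℕ × ℕ)} :
    IsBlocks (B :: C :: L) ↔ B.1 ≤ B.2 ∧ B.1 ≤ C.1 ∧ B.2 ≤ C.2 ∧ IsBlocks (C :: L) := by
  rw [isBlocks_cons]
  constructor
  · rintro ⟨h1, h2, h3⟩
    have := h2 C (by simp)
    exact ⟨h1, this.1, this.2, h3⟩
  · rintro ⟨h1, h2, h3, h4⟩
    refine ⟨h1, fun D hD => ?_, h4⟩
    have hBC : B ≤ C := ⟨h2, h3⟩
    rcases List.mem_cons.1 hD with rfl | hD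
    · exact hBC
    · exact hBC.trans ((isBlocks_cons.1 h4).2.1 D hD)

theorem isBlocks_nil : IsBlocks [] := by simp [IsBlocks]

@[simp] theorem blocksWord_nil : blocksWord [] = [] := rfl

theorem blocksWord_cons (B : ℕ × ℕ) (L : List (ℕ × ℕ)) :
    blocksWord (B :: L) = blockWord B ++ blocksWord L := rfl

theorem blocksWord_single (x : ℕ) (L : List (ℕ × ℕ)) :
    blocksWord ((x, x) :: L) = x :: blocksWord L := by simp [blocksWord_cons, blockWord]

theorem blocksWord_pair {a b : ℕ} (h : a < b) (L : List (ℕ × ℕ)) :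
    blocksWord ((a, b) :: L) = b :: a :: blocksWord L := by simp [blocksWord_cons, blockWord, h]

/-- The blocks are read greedily: a descent is split off as a pair, any other first letter as a
singleton. Descents cannot overlap, since `x > y > z` would violate `x ≤ z`. A pair removes two
letters, hence the induction on a bound for the length. -/
theorem exists_blocksWord_eq (n : ℕ) : ∀ w : List ℕ, w.length ≤ n → SkipSorted w →
    ∃ L, IsBlocks L ∧ blocksWord L = w := by
  induction n with
  | zero =>
    intro w h _
    have : w = [] := List.eq_nil_of_length_eq_zero (by omega)
    exact ⟨[], isBlocks_nil, by simp [this]⟩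
  | succ n ih =>
    intro w h hs
    match w, h, hs with
    | [], _, _ => exact ⟨[], isBlocks_nil, rfl⟩
    | [x], _, _ =>
      exact ⟨[(x, x)], by simp [isBlocks_cons, isBlocks_nil], by simp [blocksWord_single]⟩
    | x :: y :: t, h, hs =>
      simp only [List.length_cons] at h
      rcases lt_or_ge y x with hxy | hxy
      · obtain ⟨L, hL, rfl⟩ := ih t (by omega) hs.tail.tail
        refine ⟨(y, x) :: L, ?_, blocksWord_pair hxy L⟩
        match L, hL, hs with
        | [], _, _ => simp [isBlocks_cons, isBlocks_nil, hxy.le]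
        | (c, d) :: L, hL, hs =>
          rw [isBlocks_cons_cons]
          have hcd := (isBlocks_cons.1 hL).1
          simp only at hcd
          refine ⟨hxy.le, ?_, ?_, hL⟩ <;> rcases hcd.eq_or_lt with rfl | hcd
          · rw [blocksWord_single] at hs
            exact hxy.le.trans hs.1
          · rw [blocksWord_pair hcd] at hs
            exact hs.2.1
          · rw [blocksWord_single] at hs
            exact hs.1
          · rw [blocksWord_pair hcd] at hs
            exact hs.1
      · obtain ⟨L, hL, hLw⟩ := ih (y :: t) (by simp; omega) hs.tail
        rw [← hLw] at hs ⊢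
        refine ⟨(x, x) :: L, ?_, blocksWord_single x L⟩
        match L, hL, hs, hLw with
        | [], _, _, _ => simp [isBlocks_cons, isBlocks_nil]
        | (c, d) :: L, hL, hs, hLw =>
          rw [isBlocks_cons_cons]
          have hcd := (isBlocks_cons.1 hL).1
          simp only at hcd
          refine ⟨le_rfl, ?_, ?_, hL⟩ <;> rcases hcd.eq_or_lt with rfl | hcd
          · rw [blocksWord_single] at hLw
            simp at hLw; omega
          · rw [blocksWord_pair hcd] at hs
            exact hs.1
          · rw [blocksWord_single] at hLw
            simp at hLw; omega
          · rw [blocksWord_pair hcd] at hLw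
            simp at hLw; omega

theorem exists_blocksWord_cons_eq {B : ℕ × ℕ} {L : List (ℕ × ℕ)} (h : IsBlocks (B :: L)) :
    ∃ t, blocksWord (B :: L) = B.2 :: t := by
  obtain ⟨a, b⟩ := B
  rcases (isBlocks_cons.1 h).1.eq_or_lt with hab | hab
  · simp only at hab
    subst hab
    exact ⟨_, blocksWord_single _ _⟩
  · exact ⟨_, blocksWord_pair hab _⟩

theorem skipSorted_blocksWord {L : List (ℕ × ℕ)} (h : IsBlocks L) :
    SkipSorted (blocksWord L) := by
  induction L with
  | nil => simp [SkipSorted]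
  | cons B L ih =>
    have hL := (isBlocks_cons.1 h).2.2
    have ih := ih hL
    obtain ⟨a, b⟩ := B
    match L, hL, ih, h with
    | [], _, _, h => simp only [blocksWord_cons, blockWord]; split_ifs <;> simp [SkipSorted]
    | (c, d) :: L, hL, ih, h =>
      obtain ⟨h1, h2, h3, h4⟩ := isBlocks_cons_cons.1 h
      simp only at h1 h2 h3
      have hcd := (isBlocks_cons.1 hL).1
      simp only at hcd
      -- Only the lower letter of the following block matters for a letter put in front: two places
      -- further stands `c` itself if that block is a pair, and otherwise the larger letter of the
      -- block after it, if there is one.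
      have key : ∀ x ≤ c, SkipSorted (x :: blocksWord ((c, d) :: L)) := by
        intro x hx
        rcases hcd.eq_or_lt with rfl | hcd
        · rw [blocksWord_single] at ih ⊢
          match L, hL, ih with
          | [], _, _ => simp [SkipSorted]
          | B :: L, hL, ih =>
            obtain ⟨t, ht⟩ := exists_blocksWord_cons_eq (isBlocks_cons.1 hL).2.2
            rw [ht] at ih ⊢
            exact ⟨hx.trans (isBlocks_cons_cons.1 hL).2.2.1, ih⟩
        · rw [blocksWord_pair hcd] at ih ⊢
          exact ⟨hx, ih⟩
      rcases h1.eq_or_lt with rfl | h1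
      · rw [blocksWord_single]
        exact key _ h2
      · rw [blocksWord_pair h1]
        have := key a h2
        obtain ⟨t, ht⟩ := exists_blocksWord_cons_eq hL
        rw [ht] at this ⊢
        exact ⟨h3, this⟩

theorem isWord_blocksWord {k : ℕ} {L : List (ℕ × ℕ)} (h : IsBlocks L) :
    IsWord k (blocksWord L) ↔ ∀ B ∈ L, 1 ≤ B.1 ∧ B.2 ≤ k := by
  induction L with
  | nil => simp [IsWord]
  | cons B L ih =>
    obtain ⟨h1, -, h3⟩ := isBlocks_cons.1 h
    have ih := ih h3
    simp only [IsWord] at ih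
    simp only [IsWord, blocksWord_cons, List.mem_append, or_imp, forall_and, List.mem_cons,
      forall_eq] at ih ⊢
    have : ((∀ x ∈ blockWord B, 1 ≤ x) ∧ ∀ x ∈ blockWord B, x ≤ k) ↔ 1 ≤ B.1 ∧ B.2 ≤ k := by
      unfold blockWord
      split_ifs with h
      · simp; omega
      · simp; omega
    tauto

theorem mem_faroWords_iff_exists_blocks {n k : ℕ} {w : List ℕ} :
    w ∈ faroWords n k ↔ ∃ L, IsBlocks L ∧ (∀ B ∈ L, 1 ≤ B.1 ∧ B.2 ≤ k) ∧
      (blocksWord L).length = n ∧ blocksWord L = w := by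
  rw [mem_faroWords]
  constructor
  · rintro ⟨h1, h2, h3⟩
    obtain ⟨L, hL, rfl⟩ := exists_blocksWord_eq _ w le_rfl h3
    exact ⟨L, hL, (isWord_blocksWord hL).1 h2, h1, rfl⟩
  · rintro ⟨L, hL, h1, h2, rfl⟩
    exact ⟨h2, (isWord_blocksWord hL).2 h1, skipSorted_blocksWord hL⟩

/-! ### Counting blocks -/

/-- The number of pairs with smaller letter `x`. -/
def minPairs (L : List (ℕ × ℕ)) (x : ℕ) : ℕ := L.countP fun B => B.1 < B.2 ∧ B.1 = x

/-- The number of pairs with larger letter `x`. -/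
def maxPairs (L : List (ℕ × ℕ)) (x : ℕ) : ℕ := L.countP fun B => B.1 < B.2 ∧ B.2 = x

theorem isPairAt_cons_succ (a : ℕ) (w : List ℕ) (i : ℕ) :
    IsPairAt (a :: w) (i + 1) ↔ IsPairAt w i := by
  simp [IsPairAt]

theorem isPairAt_cons_zero (a : ℕ) (w : List ℕ) :
    IsPairAt (a :: w) 0 ↔ ∃ b ∈ w.head?, b < a := by
  cases w <;> simp [IsPairAt]

theorem pairsWithFirst_cons (a : ℕ) (w : List ℕ) (x : ℕ) :
    pairsWithFirst (a :: w) x =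
      pairsWithFirst w x + if IsPairAt (a :: w) 0 ∧ a = x then 1 else 0 := by
  simp only [pairsWithFirst, Finset.card_filter, List.length_cons, Finset.sum_range_succ',
    isPairAt_cons_succ, List.getD_cons_succ, List.getD_cons_zero]

theorem pairsWithSecond_cons (a : ℕ) (w : List ℕ) (x : ℕ) :
    pairsWithSecond (a :: w) x =
      pairsWithSecond w x + if IsPairAt (a :: w) 0 ∧ w.getD 0 0 = x then 1 else 0 := by
  simp only [pairsWithSecond, Finset.card_filter, List.length_cons, Finset.sum_range_succ',
    isPairAt_cons_succ, List.getD_cons_succ]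

theorem isSingletonAt_cons_succ {a : ℕ} {w : List ℕ} (h : ¬ IsPairAt (a :: w) 0) (i : ℕ) :
    IsSingletonAt (a :: w) (i + 1) ↔ IsSingletonAt w i := by
  cases i with
  | zero => simp [IsSingletonAt, isPairAt_cons_succ, h]
  | succ i => simp [IsSingletonAt, isPairAt_cons_succ]

theorem singletons_cons {a : ℕ} {w : List ℕ} (h : ¬ IsPairAt (a :: w) 0) (x : ℕ) :
    singletons (a :: w) x = singletons w x + if a = x then 1 else 0 := by
  simp only [singletons, Finset.card_filter, List.length_cons, Finset.sum_range_succ',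
    isSingletonAt_cons_succ h, List.getD_cons_succ, List.getD_cons_zero]
  simp [IsSingletonAt, h]

theorem singletons_cons_cons {a b : ℕ} {w : List ℕ} (hab : a < b) (h : ¬ IsPairAt (a :: w) 0)
    (x : ℕ) : singletons (b :: a :: w) x = singletons w x := by
  have h1 : ∀ i, IsSingletonAt (b :: a :: w) (i + 1 + 1) ↔ IsSingletonAt w i := by
    intro i
    rw [← isSingletonAt_cons_succ h]
    simp [IsSingletonAt, isPairAt_cons_succ]
  have h2 : IsPairAt (b :: a :: w) 0 := by simpa [isPairAt_cons_zero] using hab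
  simp only [singletons, Finset.card_filter, List.length_cons, Finset.sum_range_succ',
    h1, List.getD_cons_succ]
  simp [IsSingletonAt, h2]

/-- The letter after a block is the larger letter of the next block, hence at least `B.2 ≥ B.1`. So
no descent straddles two blocks, and the pairs and singletons of the word are exactly its blocks. -/
theorem not_isPairAt_zero_of_isBlocks {B : ℕ × ℕ} {L : List (ℕ × ℕ)} (h : IsBlocks (B :: L)) :
    ¬ IsPairAt (B.1 :: blocksWord L) 0 := by
  rw [isPairAt_cons_zero]
  cases L with
  | nil => simp
  | cons C L =>
    obtain ⟨h1, h2, h3, h4⟩ := isBlocks_cons_cons.1 h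
    obtain ⟨t, ht⟩ := exists_blocksWord_cons_eq h4
    simp [ht]; omega

theorem counts_blocksWord {L : List (ℕ × ℕ)} (h : IsBlocks L) (x : ℕ) :
    singletons (blocksWord L) x = L.count (x, x) ∧
    pairsWithSecond (blocksWord L) x = minPairs L x ∧
    pairsWithFirst (blocksWord L) x = maxPairs L x := by
  induction L with
  | nil => simp [singletons, pairsWithFirst, pairsWithSecond, minPairs, maxPairs]
  | cons B L ih =>
    obtain ⟨i1, i2, i3⟩ := ih (isBlocks_cons.1 h).2.2
    have h0 := not_isPairAt_zero_of_isBlocks h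
    obtain ⟨a, b⟩ := B
    simp only [minPairs, maxPairs] at i2 i3 ⊢
    rcases (isBlocks_cons.1 h).1.eq_or_lt with hab | hab
    · simp only at hab
      subst hab
      simp only at h0
      rw [blocksWord_single, singletons_cons h0, pairsWithFirst_cons, pairsWithSecond_cons,
        i1, i2, i3]
      simp [h0, List.count_cons]
    · simp only at h0 hab
      have h2 : IsPairAt (b :: a :: blocksWord L) 0 := by simpa [isPairAt_cons_zero] using hab
      rw [blocksWord_pair hab, singletons_cons_cons hab h0, pairsWithFirst_cons,
        pairsWithFirst_cons, pairsWithSecond_cons, pairsWithSecond_cons, i1, i2, i3]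
      simp only [h0, h2, List.count_cons, List.countP_cons, hab]
      simp
      omega

/-! ### Consecutive patterns of length three -/

theorem wordStat_cons (p : List ℕ) (a : ℕ) (w : List ℕ) :
    wordStat p (a :: w) =
      wordStat p w + if OrderIsomorphic p ((a :: w).take p.length) then 1 else 0 := by
  simp [wordStat, List.countP_cons]

theorem orderIsomorphic_three (p q r x y z : ℕ) :
    OrderIsomorphic [p, q, r] [x, y, z] ↔
      ((p < q ↔ x < y) ∧ (q < p ↔ y < x) ∧ (p < r ↔ x < z) ∧ (r < p ↔ z < x) ∧
        (q < r ↔ y < z) ∧ (r < q ↔ z < y)) := by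
  simp only [OrderIsomorphic, List.length_cons, List.length_nil]
  constructor
  · rintro ⟨-, h⟩
    exact ⟨h 0 (by simp) 1 (by simp), h 1 (by simp) 0 (by simp), h 0 (by simp) 2 (by simp),
      h 2 (by simp) 0 (by simp), h 1 (by simp) 2 (by simp), h 2 (by simp) 1 (by simp)⟩
  · rintro ⟨h1, h2, h3, h4, h5, h6⟩
    refine ⟨trivial, fun i hi j hj => ?_⟩
    interval_cases i <;> interval_cases j <;> simp [*]

theorem wordStat_of_length_lt {p w : List ℕ} (h : w.length < p.length) : wordStat p w = 0 := by
  unfold wordStat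
  rw [List.countP_eq_zero]
  intro t ht hp
  have h1 := (of_decide_eq_true hp).1
  have h2 := ((List.mem_tails t w).mp ht).length_le
  rw [List.length_take] at h1
  omega

theorem wordStat_three_cons (p q r x y z : ℕ) (w : List ℕ) :
    wordStat [p, q, r] (x :: y :: z :: w) = wordStat [p, q, r] (y :: z :: w) +
      if OrderIsomorphic [p, q, r] [x, y, z] then 1 else 0 := by
  rw [wordStat_cons]; rfl

/-- This disposes of 211, 221, 231, 312 and 321: each has its first letter above its third, which
letters two places apart in a faro word forbid. -/
theorem wordStat_eq_zero_of_skipSorted {p q r : ℕ} (hpr : r < p) {w : List ℕ}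
    (h : SkipSorted w) : wordStat [p, q, r] w = 0 := by
  induction w with
  | nil => exact wordStat_of_length_lt (by simp)
  | cons x w ih =>
    match w, h, ih with
    | [], _, _ => exact wordStat_of_length_lt (by simp)
    | [_], _, _ => exact wordStat_of_length_lt (by simp)
    | y :: z :: w, h, ih =>
      rw [wordStat_three_cons, ih h.tail, if_neg]
      have := h.1
      rw [orderIsomorphic_three]
      omega

/-! ### Sums over the cuts of a list -/

section Scan

variable {α : Type*}

/-- The sum of `R` over the cuts of the list `acc.reverse ++ l ++ t` that lie strictly before `t`
and not before `l`. The part to the left of a cut is passed in reverse order. -/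
def scan (R : List α → List α → ℕ) : List α → List α → List α → ℕ
  | _, [], _ => 0
  | acc, c :: l, t => R acc (c :: (l ++ t)) + scan R (c :: acc) l t

theorem scan_append (R : List α → List α → ℕ) (acc l l' t : List α) :
    scan R acc (l ++ l') t = scan R acc l (l' ++ t) + scan R (l.reverse ++ acc) l' t := by
  induction l generalizing acc with
  | nil => simp [scan]
  | cons c l ih => simp [scan, ih, add_assoc]

theorem scan_add (R R' : List α → List α → ℕ) (acc l t : List α) :
    scan (fun a b => R a b + R' a b) acc l t = scan R acc l t + scan R' acc l t := by
  induction l generalizing acc with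
  | nil => simp [scan]
  | cons c l ih => simp [scan, ih]; omega

theorem scan_sum {ι : Type*} (s : Finset ι) (R : ι → List α → List α → ℕ) (acc l t : List α) :
    scan (fun a b => ∑ i ∈ s, R i a b) acc l t = ∑ i ∈ s, scan (R i) acc l t := by
  induction l generalizing acc with
  | nil => simp [scan]
  | cons c l ih => simp [scan, ih, Finset.sum_add_distrib]

theorem scan_congr {R R' : List α → List α → ℕ} {acc l t : List α}
    (h : ∀ a b, b ≠ [] → a.reverse ++ b = acc.reverse ++ l ++ t → R a b = R' a b) :
    scan R acc l t = scan R' acc l t := by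
  induction l generalizing acc with
  | nil => simp [scan]
  | cons c l ih =>
    rw [scan, scan, h _ _ (by simp) (by simp), ih]
    intro a b hb hab
    exact h a b hb (by simp [hab])

/-- Only the cut at the left end of the run can contribute, since every other cut lies between two
elements of the run. -/
theorem scan_of_boundary {R : List α → List α → ℕ} (P : α → Prop)
    (hR : ∀ b c acc t, P b → P c → R (b :: acc) (c :: t) = 0) {l : List α} (hl : ∀ c ∈ l, P c)
    (acc t : List α) : scan R acc l t = if l = [] then 0 else R acc (l ++ t) := by
  have aux : ∀ (l : List α), (∀ c ∈ l, P c) → ∀ b acc, P b → scan R (b :: acc) l t = 0 := by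
    intro l
    induction l with
    | nil => simp [scan]
    | cons c l ih =>
      intro hl b acc hb
      rw [scan, hR _ _ _ _ hb (hl c (by simp)),
        ih (fun d hd => hl d (by simp [hd])) _ _ (hl c (by simp))]
  cases l with
  | nil => simp [scan]
  | cons c l =>
    simp [scan, aux l (fun d hd => hl d (by simp [hd])) c acc (hl c (by simp))]

theorem scan_of_consecutive {R : List α → List α → ℕ} (P : α → Prop)
    (hR : ∀ b c acc t, P b → P c → R (b :: acc) (c :: t) = 1) {l : List α} (hl : ∀ c ∈ l, P c)
    (acc t : List α) :
    scan R acc l t = (if l = [] then 0 else R acc (l ++ t)) + (l.length - 1) := by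
  have aux : ∀ (l : List α), (∀ c ∈ l, P c) → ∀ b acc, P b →
      scan R (b :: acc) l t = l.length := by
    intro l
    induction l with
    | nil => simp [scan]
    | cons c l ih =>
      intro hl b acc hb
      rw [scan, hR _ _ _ _ hb (hl c (by simp)),
        ih (fun d hd => hl d (by simp [hd])) _ _ (hl c (by simp))]
      simp [add_comm]
  cases l with
  | nil => simp [scan]
  | cons c l =>
    simp [scan, aux l (fun d hd => hl d (by simp [hd])) c acc (hl c (by simp))]

/-- The cut is placed before the last letter of `ccc`, so the first two cuts of a run of length `m`
see too few letters `c` on their left. -/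
theorem scan_replicate_of_cube {R : List α → List α → ℕ} (c : α)
    (h0 : ∀ acc t, acc.head? ≠ some c → R acc (c :: t) = 0)
    (h1 : ∀ acc t, acc.head? ≠ some c → R (c :: acc) (c :: t) = 0)
    (h2 : ∀ acc t, R (c :: c :: acc) (c :: t) = 1) (m : ℕ) (acc t : List α)
    (hacc : acc.head? ≠ some c) : scan R acc (List.replicate m c) t = m - 2 := by
  have aux : ∀ m acc, scan R (c :: c :: acc) (List.replicate m c) t = m := by
    intro m
    induction m with
    | zero => simp [scan]
    | succ m ih =>
      intro acc
      rw [List.replicate_succ, scan, h2, ih, add_comm]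
  match m with
  | 0 => simp [scan]
  | 1 => simp [scan, h0 _ _ hacc]
  | m + 2 => simp [List.replicate_succ, scan, h0 _ _ hacc, h1 _ _ hacc, aux]

/-- `R` at the cut before `c` is `R'` at the cut after `c`. The two sums differ only at the ends:
the initial cut supplies the extra summand and the final one vanishes by `h0`. -/
theorem scan_shift {R R' : List α → List α → ℕ} (h0 : ∀ acc, R' acc [] = 0)
    (h1 : ∀ c acc t, R' (c :: acc) t = R acc (c :: t)) (acc l : List α) :
    scan R acc l [] + R' acc l = scan R' acc l [] := by
  induction l generalizing acc with
  | nil => simp [scan, h0]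
  | cons c l ih => simp [scan, ← ih, h1]; omega

end Scan

/-! ### Patterns of a word in terms of its blocks -/

/-- The number of occurrences of `p` in a word with blocks `acc.reverse ++ t` that start either
with the last letter of the last block of `acc`, or, if this is a pair, with its first letter and
end outside of it. -/
def blockStat (p : List ℕ) : List (ℕ × ℕ) → List (ℕ × ℕ) → ℕ
  | B :: _, C :: t =>
    (if OrderIsomorphic p ((B.1 :: blocksWord (C :: t)).take 3) then 1 else 0) +
      if B.1 < B.2 ∧ OrderIsomorphic p [B.2, B.1, C.2] then 1 else 0
  | _, _ => 0

/-- A block has at most two letters, so an occurrence of a pattern of length three leaves the block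
in which it starts; it is charged to the cut after that block. -/
theorem wordStat_blocksWord_cons {p : List ℕ} (hp : p.length = 3) {B : ℕ × ℕ} {L : List (ℕ × ℕ)}
    (h : IsBlocks (B :: L)) (acc : List (ℕ × ℕ)) :
    wordStat p (blocksWord (B :: L)) = scan (blockStat p) (B :: acc) L [] := by
  induction L generalizing B acc with
  | nil =>
    rw [wordStat_of_length_lt]
    · simp [scan]
    · rw [hp, blocksWord_cons, blockWord]
      split_ifs <;> simp
  | cons C L ih =>
    have hC := (isBlocks_cons.1 h).2.2
    obtain ⟨t, ht⟩ := exists_blocksWord_cons_eq hC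
    rw [scan, ← ih hC]
    obtain ⟨a, b⟩ := B
    rcases (isBlocks_cons.1 h).1.eq_or_lt with hab | hab
    · simp only at hab
      subst hab
      rw [blocksWord_single, wordStat_cons]
      simp [blockStat, hp]
      omega
    · simp only at hab
      rw [blocksWord_pair hab, wordStat_cons, wordStat_cons]
      simp [blockStat, hp, hab, ht]
      omega

theorem wordStat_blocksWord {p : List ℕ} (hp : p.length = 3) {L : List (ℕ × ℕ)}
    (h : IsBlocks L) : wordStat p (blocksWord L) = scan (blockStat p) [] L [] := by
  cases L with
  | nil => simp [scan, wordStat_of_length_lt, hp]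
  | cons B L => rw [wordStat_blocksWord_cons hp h []]; simp [scan, blockStat]

theorem scan_congr_of_isBlocks {R R' : List (ℕ × ℕ) → List (ℕ × ℕ) → ℕ} {L : List (ℕ × ℕ)}
    (hL : IsBlocks L) (h0 : ∀ t, R [] t = R' [] t)
    (h : ∀ B acc C t, IsBlocks (B :: C :: t) → R (B :: acc) (C :: t) = R' (B :: acc) (C :: t)) :
    scan R [] L [] = scan R' [] L [] := by
  refine scan_congr fun a b hb hab => ?_
  match a, b, hb with
  | [], b, _ => exact h0 b
  | B :: a, C :: b, _ =>
    apply h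
    simp only [List.reverse_cons, List.append_assoc, List.cons_append, List.nil_append,
      List.reverse_nil, List.append_nil] at hab
    have hs : List.Sublist (B :: C :: b) L := hab ▸ List.sublist_append_right _ _
    exact ⟨fun D hD => hL.1 D (hs.subset hD), hL.2.sublist hs⟩

/-! ### Grouping the blocks by a common letter -/

/-- Among blocks with larger letter `x`, the pairs precede the singletons, because `(a, x) ≤ (x, x)`
for `a < x`. With a common smaller letter, as in `exists_min_segment`, the order is the opposite. -/
theorem exists_max_segment {x : ℕ} {L : List (ℕ × ℕ)} (h : IsBlocks L) (hx : ∀ B ∈ L, x ≤ B.2) :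
    ∃ A m L', L = A ++ List.replicate m (x, x) ++ L' ∧ (∀ B ∈ A, B.1 < x ∧ B.2 = x) ∧
      ∀ B ∈ L', x < B.2 := by
  induction L with
  | nil => exact ⟨[], 0, [], by simp⟩
  | cons B L ih =>
    obtain ⟨h1, h2, h3⟩ := isBlocks_cons.1 h
    rcases (hx B (by simp)).lt_or_eq with hB | hB
    · refine ⟨[], 0, B :: L, by simp, by simp, ?_⟩
      intro C hC
      rcases List.mem_cons.1 hC with rfl | hC
      · exact hB
      · exact hB.trans_le (h2 C hC).2
    · obtain ⟨A, m, L', rfl, hA, hL'⟩ := ih h3 fun C hC => hx C (by simp [hC])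
      rcases h1.lt_or_eq with hB1 | hB1
      · exact ⟨B :: A, m, L', by simp, List.forall_mem_cons.2 ⟨by omega, hA⟩, hL'⟩
      · have hA0 : A = [] := by
          rw [List.eq_nil_iff_forall_not_mem]
          intro C hC
          have := (h2 C (by simp [hC])).1
          have := (hA C hC).1
          omega
        subst hA0
        refine ⟨[], m + 1, L', ?_, by simp, hL'⟩
        have : B = (x, x) := Prod.ext (by omega) (by omega)
        simp [this, List.replicate_succ]

theorem exists_min_segment {x : ℕ} {L : List (ℕ × ℕ)} (h : IsBlocks L) (hx : ∀ B ∈ L, x ≤ B.1) :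
    ∃ m A L', L = List.replicate m (x, x) ++ A ++ L' ∧ (∀ B ∈ A, B.1 = x ∧ x < B.2) ∧
      ∀ B ∈ L', x < B.1 := by
  induction L with
  | nil => exact ⟨0, [], [], by simp⟩
  | cons B L ih =>
    obtain ⟨h1, h2, h3⟩ := isBlocks_cons.1 h
    rcases (hx B (by simp)).lt_or_eq with hB | hB
    · refine ⟨0, [], B :: L, by simp, by simp, ?_⟩
      intro C hC
      rcases List.mem_cons.1 hC with rfl | hC
      · exact hB
      · exact hB.trans_le (h2 C hC).1
    · obtain ⟨m, A, L', rfl, hA, hL'⟩ := ih h3 fun C hC => hx C (by simp [hC])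
      rcases h1.lt_or_eq with hB1 | hB1
      · have hm : m = 0 := by
          by_contra hm
          have := (h2 (x, x) (by simp [hm])).2
          simp only at this
          omega
        subst hm
        exact ⟨0, B :: A, L', by simp, List.forall_mem_cons.2 ⟨by omega, hA⟩, hL'⟩
      · refine ⟨m + 1, A, L', ?_, hA, hL'⟩
        have : B = (x, x) := Prod.ext (by omega) (by omega)
        simp [this, List.replicate_succ]

/-- Some block contains a letter smaller than `x`. -/
def HasBelow (L : List (ℕ × ℕ)) (x : ℕ) : Prop := ∃ B ∈ L, B.1 < x

/-- Some block contains a letter larger than `x`. -/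
def HasAbove (L : List (ℕ × ℕ)) (x : ℕ) : Prop := ∃ B ∈ L, x < B.2

/-- The scan is cut into segments with constant larger letter `x`. The description of `HasBelow`
needs a singleton `x`: without one, a letter below `x` may belong to a pair that lies later because
its larger letter exceeds `x`. A block with a letter above `x`, by contrast, always comes after the
segment. -/
theorem scan_eq_sum_of_max_segment {k : ℕ} {L : List (ℕ × ℕ)} (hL : IsBlocks L)
    (hk : ∀ B ∈ L, 1 ≤ B.1 ∧ B.2 ≤ k) (R : List (ℕ × ℕ) → List (ℕ × ℕ) → ℕ) (f : ℕ → ℕ)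
    (hf : ∀ x acc A m t, (∀ B ∈ acc, B.1 ≤ B.2 ∧ B.2 < x) → (∀ B ∈ A, B.1 < x ∧ B.2 = x) →
      (∀ B ∈ t, x < B.2) → L.count (x, x) = m → maxPairs L x = A.length →
      (0 < m → (HasBelow L x ↔ A.reverse ++ acc ≠ [])) → (HasAbove L x ↔ t ≠ []) →
      scan R acc A (List.replicate m (x, x) ++ t) +
        scan R (A.reverse ++ acc) (List.replicate m (x, x)) t = f x) :
    scan R [] L [] = ∑ x ∈ Finset.Ico 1 (k + 1), f x := by
  have key : ∀ n x acc t, x + n = k + 1 → acc.reverse ++ t = L → (∀ B ∈ acc, B.2 < x) →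
      (∀ B ∈ t, x ≤ B.2) → scan R acc t [] = ∑ y ∈ Finset.Ico x (k + 1), f y := by
    intro n
    induction n with
    | zero =>
      intro x acc t hx hat _ ht
      have : t = [] := by
        rw [List.eq_nil_iff_forall_not_mem]
        intro B hB
        have h1 := ht B hB
        have h2 := (hk B (by rw [← hat]; simp [hB])).2
        omega
      subst this
      simp [scan, show x = k + 1 by omega]
    | succ n ih =>
      intro x acc t hx hat hacc ht
      have hs : List.Sublist t L := hat ▸ List.sublist_append_right _ _
      obtain ⟨A, m, t, rfl, hA, ht'⟩ := exists_max_segment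
        ⟨fun D hD => hL.1 D (hs.subset hD), hL.2.sublist hs⟩ ht
      rw [Finset.sum_eq_sum_Ico_succ_bot (by omega), scan_append, scan_append,
        List.append_nil, ih (x + 1) _ t (by omega) (by simpa using hat)]
      · congr 1
        refine hf x acc A m t (fun B hB => ⟨hL.1 B (by rw [← hat]; simp [hB]), hacc B hB⟩)
          hA ht' ?_ ?_ ?_ ?_
        · rw [← hat]
          have h1 : (x, x) ∉ acc := fun h => lt_irrefl _ (hacc _ h)
          have h2 : (x, x) ∉ A := fun h => lt_irrefl _ (hA _ h).1
          have h3 : (x, x) ∉ t := fun h => lt_irrefl _ (ht' _ h)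
          simp [List.count_append, List.count_eq_zero_of_not_mem, h1, h2, h3]
        · rw [← hat, maxPairs, List.countP_append, List.countP_append, List.countP_append,
            List.countP_eq_zero.2, List.countP_eq_length.2, List.countP_eq_zero.2,
            List.countP_eq_zero.2]
          · simp
          · intro B hB; have := ht' B hB; simp; omega
          · intro B hB; rw [List.eq_of_mem_replicate hB]; simp
          · intro B hB; have := hA B hB; simp; omega
          · intro B hB; have := hacc B (by simpa using hB); simp; omega
        · intro hm
          constructor
          · rintro ⟨B, hB, hBx⟩ h0
            have hA0 : A = [] := by simpa using (List.append_eq_nil_iff.1 h0).1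
            have hacc0 := (List.append_eq_nil_iff.1 h0).2
            subst hA0 hacc0
            obtain ⟨m, rfl⟩ : ∃ m', m = m' + 1 := ⟨m - 1, by omega⟩
            simp only [List.reverse_nil, List.nil_append, List.replicate_succ,
              List.cons_append] at hat
            rw [← hat] at hL hB
            rcases List.mem_cons.1 hB with rfl | hB
            · exact lt_irrefl _ hBx
            · exact absurd ((isBlocks_cons.1 hL).2.1 B hB).1 (by simpa using hBx)
          · intro h0
            obtain ⟨B, hB⟩ := List.exists_mem_of_ne_nil _ h0
            have hBL : B ∈ L := by
              rw [← hat]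
              simp only [List.mem_append, List.mem_reverse] at hB ⊢
              tauto
            refine ⟨B, hBL, ?_⟩
            rcases List.mem_append.1 hB with hB | hB
            · exact (hA B (by simpa using hB)).1
            · exact (hL.1 B hBL).trans_lt (hacc B hB)
        · constructor
          · rintro ⟨B, hB, hBx⟩ rfl
            rw [← hat] at hB
            simp only [List.append_nil, List.mem_append, List.mem_reverse] at hB
            rcases hB with hB | hB | hB
            · have := hacc B hB; omega
            · have := hA B hB; omega
            · rw [List.eq_of_mem_replicate hB] at hBx; simp at hBx
          · intro h0
            obtain ⟨B, hB⟩ := List.exists_mem_of_ne_nil _ h0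
            exact ⟨B, by rw [← hat]; simp [hB], ht' B hB⟩
      · intro B hB
        simp only [List.mem_append, List.mem_reverse, List.reverse_append] at hB
        rcases hB with (hB | hB) | hB
        · rw [List.eq_of_mem_replicate hB]; simp
        · have := hA B hB; omega
        · have := hacc B hB; omega
      · intro B hB
        exact ht' B hB
  exact key k 1 [] L (by omega) (by simp) (by simp) fun B hB => (hk B hB).1.trans (hL.1 B hB)

/-- With segments of constant smaller letter, the blocks before the segment of `x` are exactly those
having a letter below `x`, so `HasBelow` is described without assuming a singleton. -/
theorem scan_eq_sum_of_min_segment {k : ℕ} {L : List (ℕ × ℕ)} (hL : IsBlocks L)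
    (hk : ∀ B ∈ L, 1 ≤ B.1 ∧ B.2 ≤ k) (R : List (ℕ × ℕ) → List (ℕ × ℕ) → ℕ) (f : ℕ → ℕ)
    (hf : ∀ x acc m A t, (∀ B ∈ acc, B.1 < x) → (∀ B ∈ A, B.1 = x ∧ x < B.2) →
      (∀ B ∈ t, x < B.1) → L.count (x, x) = m → minPairs L x = A.length →
      (HasBelow L x ↔ acc ≠ []) →
      scan R acc (List.replicate m (x, x)) (A ++ t) +
        scan R ((List.replicate m (x, x)).reverse ++ acc) A t = f x) :
    scan R [] L [] = ∑ x ∈ Finset.Ico 1 (k + 1), f x := by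
  have key : ∀ n x acc t, x + n = k + 1 → acc.reverse ++ t = L → (∀ B ∈ acc, B.1 < x) →
      (∀ B ∈ t, x ≤ B.1) → scan R acc t [] = ∑ y ∈ Finset.Ico x (k + 1), f y := by
    intro n
    induction n with
    | zero =>
      intro x acc t hx hat _ ht
      have : t = [] := by
        rw [List.eq_nil_iff_forall_not_mem]
        intro B hB
        have hBL : B ∈ L := by rw [← hat]; simp [hB]
        have h1 := ht B hB
        have h2 := (hk B hBL).2
        have h3 := hL.1 B hBL
        omega
      subst this
      simp [scan, show x = k + 1 by omega]
    | succ n ih =>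
      intro x acc t hx hat hacc ht
      have hs : List.Sublist t L := hat ▸ List.sublist_append_right _ _
      obtain ⟨m, A, t, rfl, hA, ht'⟩ := exists_min_segment
        ⟨fun D hD => hL.1 D (hs.subset hD), hL.2.sublist hs⟩ ht
      rw [Finset.sum_eq_sum_Ico_succ_bot (by omega), scan_append, scan_append,
        List.append_nil, ih (x + 1) _ t (by omega) (by simpa using hat)]
      · congr 1
        refine hf x acc m A t hacc hA ht' ?_ ?_ ?_
        · rw [← hat]
          have h1 : (x, x) ∉ acc := fun h => lt_irrefl _ (hacc _ h)
          have h2 : (x, x) ∉ A := fun h => lt_irrefl _ (hA _ h).2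
          have h3 : (x, x) ∉ t := fun h => lt_irrefl _ (ht' _ h)
          simp [List.count_append, List.count_eq_zero_of_not_mem, h1, h2, h3]
        · rw [← hat, minPairs, List.countP_append, List.countP_append, List.countP_append,
            List.countP_eq_zero.2, List.countP_eq_zero.2, List.countP_eq_length.2,
            List.countP_eq_zero.2]
          · simp
          · intro B hB; have := ht' B hB; simp; omega
          · intro B hB; have := hA B hB; simp; omega
          · intro B hB; rw [List.eq_of_mem_replicate hB]; simp
          · intro B hB; have := hacc B (by simpa using hB); simp; omega
        · constructor
          · rintro ⟨B, hB, hBx⟩ rfl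
            rw [← hat] at hB
            have := ht B (by simpa using hB)
            omega
          · intro h0
            obtain ⟨B, hB⟩ := List.exists_mem_of_ne_nil _ h0
            exact ⟨B, by rw [← hat]; simp [hB], hacc B hB⟩
      · intro B hB
        simp only [List.mem_append, List.mem_reverse, List.reverse_append] at hB
        rcases hB with (hB | hB) | hB
        · have := hA B hB; omega
        · rw [List.eq_of_mem_replicate hB]; simp
        · have := hacc B hB; omega
      · intro B hB
        exact ht' B hB
  exact key k 1 [] L (by omega) (by simp) (by simp) fun B hB => (hk B hB).1

instance (L : List (ℕ × ℕ)) (x : ℕ) : Decidable (HasBelow L x) := by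
  unfold HasBelow; infer_instance

instance (L : List (ℕ × ℕ)) (x : ℕ) : Decidable (HasAbove L x) := by
  unfold HasAbove; infer_instance

/-! ### Patterns as local conditions on consecutive blocks -/

theorem blockStat_of_pair (p q r : ℕ) (B : ℕ × ℕ) {C : ℕ × ℕ} (hC : C.1 < C.2)
    (acc t : List (ℕ × ℕ)) : blockStat [p, q, r] (B :: acc) (C :: t) =
      (if OrderIsomorphic [p, q, r] [B.1, C.2, C.1] then 1 else 0) +
        if B.1 < B.2 ∧ OrderIsomorphic [p, q, r] [B.2, B.1, C.2] then 1 else 0 := by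
  obtain ⟨c, d⟩ := C
  simp only at hC
  simp [blockStat, blocksWord_pair hC]

theorem blockStat_of_single_last (p q r : ℕ) (B : ℕ × ℕ) {C : ℕ × ℕ} (hC : C.1 = C.2)
    (acc : List (ℕ × ℕ)) : blockStat [p, q, r] (B :: acc) [C] =
      if B.1 < B.2 ∧ OrderIsomorphic [p, q, r] [B.2, B.1, C.2] then 1 else 0 := by
  obtain ⟨c, d⟩ := C
  simp only at hC
  subst hC
  have : ¬ OrderIsomorphic [p, q, r] [B.1, c] := fun h => by simp [OrderIsomorphic] at h
  simp [blockStat, blocksWord_single, this]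

theorem blockStat_of_single (p q r : ℕ) (B : ℕ × ℕ) {C : ℕ × ℕ} (hC : C.1 = C.2) {D : ℕ × ℕ}
    {acc t : List (ℕ × ℕ)} (h : IsBlocks (D :: t)) :
    blockStat [p, q, r] (B :: acc) (C :: D :: t) =
      (if OrderIsomorphic [p, q, r] [B.1, C.2, D.2] then 1 else 0) +
        if B.1 < B.2 ∧ OrderIsomorphic [p, q, r] [B.2, B.1, C.2] then 1 else 0 := by
  obtain ⟨c, d⟩ := C
  simp only at hC
  subst hC
  obtain ⟨u, hu⟩ := exists_blocksWord_cons_eq h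
  simp [blockStat, blocksWord_single, hu]

/-- Rewriting the pattern statistic with a predicate on two consecutive blocks and on the block
after them. -/
theorem wordStat_eq_scan {p q r : ℕ} {L : List (ℕ × ℕ)} (hL : IsBlocks L)
    {R : List (ℕ × ℕ) → List (ℕ × ℕ) → ℕ} (h0 : ∀ t, R [] t = 0)
    (h1 : ∀ B C acc t, B.1 ≤ B.2 → C.1 < C.2 → B.1 ≤ C.1 → B.2 ≤ C.2 →
      R (B :: acc) (C :: t) = (if OrderIsomorphic [p, q, r] [B.1, C.2, C.1] then 1 else 0) +
        if B.1 < B.2 ∧ OrderIsomorphic [p, q, r] [B.2, B.1, C.2] then 1 else 0)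
    (h2 : ∀ B C acc, B.1 ≤ B.2 → C.1 = C.2 → B.1 ≤ C.1 → B.2 ≤ C.2 → R (B :: acc) [C] =
      if B.1 < B.2 ∧ OrderIsomorphic [p, q, r] [B.2, B.1, C.2] then 1 else 0)
    (h3 : ∀ B C D acc t, B.1 ≤ B.2 → C.1 = C.2 → B.1 ≤ C.1 → B.2 ≤ C.2 → C.1 ≤ D.1 →
      C.2 ≤ D.2 → D.1 ≤ D.2 → R (B :: acc) (C :: D :: t) =
      (if OrderIsomorphic [p, q, r] [B.1, C.2, D.2] then 1 else 0) +
        if B.1 < B.2 ∧ OrderIsomorphic [p, q, r] [B.2, B.1, C.2] then 1 else 0) :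
    wordStat [p, q, r] (blocksWord L) = scan R [] L [] := by
  rw [wordStat_blocksWord rfl hL]
  refine scan_congr_of_isBlocks hL (fun t => by simp [h0, blockStat]) fun B acc C t h => ?_
  obtain ⟨a1, a2, a3, a4⟩ := isBlocks_cons_cons.1 h
  rcases (isBlocks_cons.1 a4).1.lt_or_eq with hC | hC
  · rw [blockStat_of_pair p q r B hC, h1 B C acc t a1 hC a2 a3]
  · cases t with
    | nil => rw [blockStat_of_single_last p q r B hC, h2 B C acc a1 hC a2 a3]
    | cons D t =>
      obtain ⟨b1, b2, b3, b4⟩ := isBlocks_cons_cons.1 a4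
      rw [blockStat_of_single p q r B hC b4, h3 B C D acc t a1 hC a2 a3 b2 b3
        (isBlocks_cons.1 b4).1]

/-- The cuts in the middle of a pattern `121`, where the first letter is a singleton. -/
def cut121Single : List (ℕ × ℕ) → List (ℕ × ℕ) → ℕ
  | B :: _, C :: _ => if B.1 = B.2 ∧ B.1 = C.1 ∧ C.1 < C.2 then 1 else 0
  | _, _ => 0

/-- The cuts in the middle of a pattern `121`, where the first letter belongs to a pair. -/
def cut121Pair : List (ℕ × ℕ) → List (ℕ × ℕ) → ℕ
  | B :: _, C :: _ => if B.1 < B.2 ∧ B.1 = C.1 ∧ C.1 < C.2 then 1 else 0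
  | _, _ => 0

/-- The cuts in the middle of a pattern `212`, where the last letter is a singleton. -/
def cut212Single : List (ℕ × ℕ) → List (ℕ × ℕ) → ℕ
  | B :: _, C :: _ => if B.1 < B.2 ∧ C.1 = C.2 ∧ C.2 = B.2 then 1 else 0
  | _, _ => 0

/-- The cuts in the middle of a pattern `212`, where the last letter belongs to a pair. -/
def cut212Pair : List (ℕ × ℕ) → List (ℕ × ℕ) → ℕ
  | B :: _, C :: _ => if B.1 < B.2 ∧ C.1 < C.2 ∧ C.2 = B.2 then 1 else 0
  | _, _ => 0

/-- The cuts in the middle of a pattern `132`. -/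
def cut132 : List (ℕ × ℕ) → List (ℕ × ℕ) → ℕ
  | B :: _, C :: _ => if B.1 < C.1 ∧ C.1 < C.2 then 1 else 0
  | _, _ => 0

/-- The cuts in the middle of a pattern `213`. -/
def cut213 : List (ℕ × ℕ) → List (ℕ × ℕ) → ℕ
  | B :: _, C :: _ => if B.1 < B.2 ∧ B.2 < C.2 then 1 else 0
  | _, _ => 0

/-- The cuts after the first letter of a pattern `122`. -/
def cut122 : List (ℕ × ℕ) → List (ℕ × ℕ) → ℕ
  | B :: _, C :: D :: _ => if B.1 < C.1 ∧ C.1 = C.2 ∧ D.2 = C.2 then 1 else 0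
  | _, _ => 0

/-- The cuts after the first letter of a pattern `123`. -/
def cut123 : List (ℕ × ℕ) → List (ℕ × ℕ) → ℕ
  | B :: _, C :: D :: _ => if B.1 < C.1 ∧ C.1 = C.2 ∧ C.2 < D.2 then 1 else 0
  | _, _ => 0

/-- The cuts after the first letter of a pattern `111`. -/
def cut111 : List (ℕ × ℕ) → List (ℕ × ℕ) → ℕ
  | B :: _, C :: D :: _ => if B.1 = B.2 ∧ B = C ∧ C = D then 1 else 0
  | _, _ => 0

/-- The cuts after the first letter of a pattern `112`. -/
def cut112 : List (ℕ × ℕ) → List (ℕ × ℕ) → ℕ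
  | B :: _, C :: D :: _ => if B.1 = B.2 ∧ B = C ∧ C.2 < D.2 then 1 else 0
  | _, _ => 0

/-- The cuts before the pair of a pattern `213`. -/
def cutBefore213 : List (ℕ × ℕ) → List (ℕ × ℕ) → ℕ
  | _, B :: C :: _ => if B.1 < B.2 ∧ B.2 < C.2 then 1 else 0
  | _, _ => 0

/-! ### Pattern counts as sums over the letters -/

section Sums

variable {L : List (ℕ × ℕ)} {k : ℕ}

/-- The last two letters form a pair with smaller letter `x`, and the preceding block has smaller
letter `x` too. In the segment of `x`, singletons followed by pairs, this happens once where the two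
runs meet and once between any two neighbouring pairs. -/
theorem wordStat_121 (hL : IsBlocks L) (hk : ∀ B ∈ L, 1 ≤ B.1 ∧ B.2 ≤ k) :
    wordStat [1, 2, 1] (blocksWord L) = ∑ x ∈ Finset.Ico 1 (k + 1),
      ((if 0 < L.count (x, x) ∧ 0 < minPairs L x then 1 else 0) + (minPairs L x - 1)) := by
  rw [wordStat_eq_scan hL (R := fun a t => cut121Single a t + cut121Pair a t)]
  · rw [scan_add, Finset.sum_add_distrib]
    congr 1
    · refine scan_eq_sum_of_min_segment hL hk _ _ ?_
      intro x acc m A t hacc hA ht hm hq _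
      rw [List.reverse_replicate, hm, hq, scan_of_boundary (fun B => B.1 = B.2),
        scan_of_boundary (fun B => B.1 = x ∧ x < B.2)]
      · match m, A, hA with
        | 0, [], _ => simp
        | m + 1, [], _ =>
          cases acc <;> simp [List.replicate_succ, cut121Single]
        | 0, B :: A, hA =>
          cases acc with
          | nil => simp [cut121Single]
          | cons C acc =>
            have := hA B (by simp)
            have := hacc C (by simp)
            simp [cut121Single]; omega
        | m + 1, B :: A, hA =>
          have := hA B (by simp)
          cases acc <;> simp [List.replicate_succ, cut121Single] <;> omega
      · intro b c acc t hb hc; simp [cut121Single]; omega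
      · exact hA
      · intro b c acc t hb hc; simp [cut121Single]; omega
      · intro c hc; rw [List.eq_of_mem_replicate hc]
    · refine scan_eq_sum_of_min_segment hL hk _ _ ?_
      intro x acc m A t hacc hA ht hm hq _
      rw [List.reverse_replicate, hq, scan_of_boundary (fun B => B.1 = B.2),
        scan_of_consecutive (fun B => B.1 = x ∧ x < B.2)]
      · match m, A, hA with
        | 0, [], _ => simp
        | m + 1, [], _ =>
          cases acc <;> simp [List.replicate_succ, cut121Pair]
        | 0, B :: A, hA =>
          cases acc with
          | nil => simp [cut121Pair]
          | cons C acc =>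
            have := hA B (by simp)
            have := hacc C (by simp)
            simp [cut121Pair]; omega
        | m + 1, B :: A, hA =>
          have := hA B (by simp)
          cases acc <;> simp [List.replicate_succ, cut121Pair]
      · intro b c acc t hb hc; simp [cut121Pair]; omega
      · exact hA
      · intro b c acc t hb hc; simp [cut121Pair]; omega
      · intro c hc; rw [List.eq_of_mem_replicate hc]
  · intro t; simp [cut121Single, cut121Pair]
  · intro B C acc t h1 h2 h3 h4
    simp only [orderIsomorphic_three, cut121Single, cut121Pair]
    split_ifs <;> omega
  · intro B C acc h1 h2 h3 h4
    simp only [orderIsomorphic_three, cut121Single, cut121Pair]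
    split_ifs <;> omega
  · intro B C D acc t h1 h2 h3 h4 h5 h6 h7
    simp only [orderIsomorphic_three, cut121Single, cut121Pair]
    split_ifs <;> omega

/-- The last two letters are a pair with smaller letter `x`, and the preceding block has a smaller
lower letter. So the pair opens the segment of `x`, which therefore contains no singletons, and is
not the first block. -/
theorem wordStat_132 (hL : IsBlocks L) (hk : ∀ B ∈ L, 1 ≤ B.1 ∧ B.2 ≤ k) :
    wordStat [1, 3, 2] (blocksWord L) = ∑ x ∈ Finset.Ico 1 (k + 1),
      if L.count (x, x) = 0 ∧ 0 < minPairs L x ∧ HasBelow L x then 1 else 0 := by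
  rw [wordStat_eq_scan hL (R := cut132)]
  · refine scan_eq_sum_of_min_segment hL hk _ _ ?_
    intro x acc m A t hacc hA ht hm hq hlo
    rw [List.reverse_replicate, hm, hq, scan_of_boundary (fun B => B.1 = x),
      scan_of_boundary (fun B => B.1 = x)]
    · simp only [hlo]
      match m, A, hA with
      | 0, [], _ => simp
      | m + 1, [], _ =>
        cases acc <;> simp [List.replicate_succ, cut132]
      | 0, B :: A, hA =>
        cases acc with
        | nil => simp [cut132]
        | cons C acc =>
          have := hA B (by simp)
          have := hacc C (by simp)
          simp [cut132]; omega
      | m + 1, B :: A, hA =>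
        have := hA B (by simp)
        cases acc <;> simp [List.replicate_succ, cut132] <;> omega
    · intro b c acc t hb hc; simp [cut132]; omega
    · exact fun B hB => (hA B hB).1
    · intro b c acc t hb hc; simp [cut132]; omega
    · intro c hc; rw [List.eq_of_mem_replicate hc]
  · intro t; simp [cut132]
  · intro B C acc t h1 h2 h3 h4
    simp only [orderIsomorphic_three, cut132]
    split_ifs <;> omega
  · intro B C acc h1 h2 h3 h4
    simp only [orderIsomorphic_three, cut132]
    split_ifs <;> omega
  · intro B C D acc t h1 h2 h3 h4 h5 h6 h7
    simp only [orderIsomorphic_three, cut132]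
    split_ifs <;> omega

/-- The first two letters are a pair with larger letter `x` and the next block has the same larger
letter. In the segment of `x`, pairs followed by singletons, this happens where the runs meet and
between neighbouring pairs. -/
theorem wordStat_212 (hL : IsBlocks L) (hk : ∀ B ∈ L, 1 ≤ B.1 ∧ B.2 ≤ k) :
    wordStat [2, 1, 2] (blocksWord L) = ∑ x ∈ Finset.Ico 1 (k + 1),
      ((if 0 < L.count (x, x) ∧ 0 < maxPairs L x then 1 else 0) + (maxPairs L x - 1)) := by
  rw [wordStat_eq_scan hL (R := fun a t => cut212Single a t + cut212Pair a t)]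
  · rw [scan_add, Finset.sum_add_distrib]
    congr 1
    · refine scan_eq_sum_of_max_segment hL hk _ _ ?_
      intro x acc A m t hacc hA ht hm hq _ _
      rw [hm, hq, scan_of_boundary (fun B => B.1 < x ∧ B.2 = x),
        scan_of_boundary (fun B => B.1 = B.2)]
      · rw [← List.length_reverse]
        have hA' : ∀ B ∈ A.reverse, B.1 < x ∧ B.2 = x := by simpa using hA
        have h1 : (if A = [] then 0 else
            cut212Single acc (A ++ (List.replicate m (x, x) ++ t))) = 0 := by
          match A, hA with
          | [], _ => simp
          | B :: A, hA =>
            have := hA B (by simp)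
            cases acc <;> simp [cut212Single]; omega
        rw [h1]
        generalize A.reverse = A' at hA'
        match m, A', hA' with
        | 0, _, _ => simp
        | m + 1, [], _ =>
          cases acc with
          | nil => simp [List.replicate_succ, cut212Single]
          | cons C acc =>
            have := hacc C (by simp)
            simp [List.replicate_succ, cut212Single]; omega
        | m + 1, B :: A', hA =>
          have := hA B (by simp)
          simp [List.replicate_succ, cut212Single]; omega
      · intro b c acc t hb hc; simp [cut212Single]; omega
      · intro c hc; rw [List.eq_of_mem_replicate hc]
      · intro b c acc t hb hc; simp [cut212Single]; omega
      · exact hA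
    · refine scan_eq_sum_of_max_segment hL hk _ _ ?_
      intro x acc A m t hacc hA ht hm hq _ _
      rw [hq, scan_of_consecutive (fun B => B.1 < x ∧ B.2 = x),
        scan_of_boundary (fun B => B.1 = B.2)]
      · have h1 : (if A = [] then 0 else
            cut212Pair acc (A ++ (List.replicate m (x, x) ++ t))) = 0 := by
          match A, hA with
          | [], _ => simp
          | B :: A, hA =>
            have := hA B (by simp)
            cases acc with
            | nil => simp [cut212Pair]
            | cons C acc =>
              have := hacc C (by simp)
              simp [cut212Pair]; omega
        rw [h1]
        cases m with
        | zero => simp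
        | succ m => cases A.reverse ++ acc <;> simp [List.replicate_succ, cut212Pair]
      · intro b c acc t hb hc; simp [cut212Pair]; omega
      · intro c hc; rw [List.eq_of_mem_replicate hc]
      · intro b c acc t hb hc; simp [cut212Pair]; omega
      · exact hA
  · intro t; simp [cut212Single, cut212Pair]
  · intro B C acc t h1 h2 h3 h4
    simp only [orderIsomorphic_three, cut212Single, cut212Pair]
    split_ifs <;> omega
  · intro B C acc h1 h2 h3 h4
    simp only [orderIsomorphic_three, cut212Single, cut212Pair]
    split_ifs <;> omega
  · intro B C D acc t h1 h2 h3 h4 h5 h6 h7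
    simp only [orderIsomorphic_three, cut212Single, cut212Pair]
    split_ifs <;> omega

theorem wordStat_213 (hL : IsBlocks L) (hk : ∀ B ∈ L, 1 ≤ B.1 ∧ B.2 ≤ k) :
    wordStat [2, 1, 3] (blocksWord L) = ∑ x ∈ Finset.Ico 1 (k + 1),
      if L.count (x, x) = 0 ∧ 0 < maxPairs L x ∧ HasAbove L x then 1 else 0 := by
  rw [wordStat_eq_scan hL (R := cut213)]
  · have hs : scan cutBefore213 [] L [] = scan cut213 [] L [] := by
      rw [← scan_shift (R := cutBefore213) (R' := cut213)]
      · simp [cut213]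
      · intro acc; cases acc <;> simp [cut213]
      · intro B acc t; cases t <;> simp [cut213, cutBefore213]
    rw [← hs]
    refine scan_eq_sum_of_max_segment hL hk _ _ ?_
    intro x acc A m t hacc hA ht hm hq _ hhi
    have h1 : ∀ (A acc u : List (ℕ × ℕ)), (∀ B ∈ A, B.1 < x ∧ B.2 = x) →
        scan cutBefore213 acc A u = if A ≠ [] ∧ ∃ C ∈ u.head?, x < C.2 then 1 else 0 := by
      intro A
      induction A with
      | nil => simp [scan]
      | cons B A ih =>
        intro acc u hA
        have hB := hA B (by simp)
        rw [scan, ih _ _ fun C hC => hA C (by simp [hC])]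
        match A, u with
        | C :: A, u =>
          have hC := hA C (by simp)
          have h0 : ¬ x < C.2 := by omega
          simp only [List.cons_append, cutBefore213, hB.2, hC.2, lt_irrefl, and_false, if_false,
            zero_add]
          exact if_congr (by simp) rfl rfl
        | [], [] => simp [cutBefore213]
        | [], C :: u => simp [cutBefore213, hB]
    have h2 : ∀ (m : ℕ) (acc : List (ℕ × ℕ)),
        scan cutBefore213 acc (List.replicate m (x, x)) t = 0 := by
      intro m
      induction m with
      | zero => simp [scan]
      | succ m ih =>
        intro acc
        rw [List.replicate_succ, scan, ih]
        cases List.replicate m (x, x) ++ t <;> simp [cutBefore213]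
    rw [h1 _ _ _ hA, h2, hm, hq]
    simp only [hhi, List.length_pos_iff]
    match m, t, ht with
    | 0, [], _ => simp
    | 0, C :: t, ht => simp [ht C]
    | m + 1, _, _ => simp [List.replicate_succ]
  · intro t; simp [cut213]
  · intro B C acc t h1 h2 h3 h4
    simp only [orderIsomorphic_three, cut213]
    split_ifs <;> omega
  · intro B C acc h1 h2 h3 h4
    simp only [orderIsomorphic_three, cut213]
    split_ifs <;> omega
  · intro B C D acc t h1 h2 h3 h4 h5 h6 h7
    simp only [orderIsomorphic_three, cut213]
    split_ifs <;> omega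

theorem scan_cut_max_eq_zero {R : List (ℕ × ℕ) → List (ℕ × ℕ) → ℕ}
    (hR : ∀ acc C t, C.1 < C.2 → R acc (C :: t) = 0) {A : List (ℕ × ℕ)}
    (hA : ∀ B ∈ A, B.1 < B.2) (acc u : List (ℕ × ℕ)) : scan R acc A u = 0 := by
  induction A generalizing acc with
  | nil => simp [scan]
  | cons B A ih => rw [scan, hR _ _ _ (hA B (by simp)), ih fun C hC => hA C (by simp [hC])]

/-- For 111, 112, 122 and 123 the cut after the first letter is followed by a singleton: the second
letter starts a block and is not followed by a smaller one. So only the runs of equal singletons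
have to be scanned. -/
theorem scan_eq_sum_of_singles (hL : IsBlocks L) (hk : ∀ B ∈ L, 1 ≤ B.1 ∧ B.2 ≤ k)
    (R : List (ℕ × ℕ) → List (ℕ × ℕ) → ℕ) (f : ℕ → ℕ)
    (hR : ∀ acc C t, C.1 < C.2 → R acc (C :: t) = 0)
    (hf : ∀ x acc m t, (∀ B ∈ acc, B.1 < x) → (∀ B ∈ t, x < B.2) →
      L.count (x, x) = m → (0 < m → (HasBelow L x ↔ acc ≠ [])) → (HasAbove L x ↔ t ≠ []) →
      scan R acc (List.replicate m (x, x)) t = f x) :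
    scan R [] L [] = ∑ x ∈ Finset.Ico 1 (k + 1), f x := by
  refine scan_eq_sum_of_max_segment hL hk _ _ ?_
  intro x acc A m t hacc hA ht hm hq hlo hhi
  rw [scan_cut_max_eq_zero hR (fun B hB => by have := hA B hB; omega), zero_add]
  refine hf x _ m t (fun B hB => ?_) ht hm hlo hhi
  rcases List.mem_append.1 hB with hB | hB
  · exact (hA B (by simpa using hB)).1
  · exact (hacc B hB).1.trans_lt (hacc B hB).2

/-- The cut must lie at the start of the run of singletons `x`. The third letter, being the larger
letter of a block after `(x, x)`, equals `x` only if that block is again `(x, x)`. -/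
theorem wordStat_122 (hL : IsBlocks L) (hk : ∀ B ∈ L, 1 ≤ B.1 ∧ B.2 ≤ k) :
    wordStat [1, 2, 2] (blocksWord L) = ∑ x ∈ Finset.Ico 1 (k + 1),
      if 2 ≤ L.count (x, x) ∧ HasBelow L x then 1 else 0 := by
  rw [wordStat_eq_scan hL (R := cut122)]
  · refine scan_eq_sum_of_singles hL hk _ _ ?_ ?_
    · intro acc C t hC
      cases acc <;> cases t <;> simp [cut122]; omega
    intro x acc m t hacc ht hm hlo _
    rw [hm, scan_of_boundary (fun B => B = (x, x))]
    · match m, acc, t with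
      | 0, _, _ => simp
      | 1, [], _ => simp [cut122]
      | 1, B :: acc, [] => simp [cut122]
      | 1, B :: acc, C :: t => have := ht C (by simp); simp [cut122]; omega
      | m + 2, [], t => simp [hlo, cut122]
      | m + 2, B :: acc, t =>
        simp [hlo, List.replicate_succ, cut122, hacc B]
    · intro b c acc t hb hc; subst hb hc; cases t <;> simp [cut122]
    · intro c hc; rw [List.eq_of_mem_replicate hc]
  · intro t; simp [cut122]
  · intro B C acc t h1 h2 h3 h4
    cases t <;> simp only [orderIsomorphic_three, cut122] <;>
    split_ifs <;> omega
  · intro B C acc h1 h2 h3 h4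
    simp only [orderIsomorphic_three, cut122]
    split_ifs <;> omega
  · intro B C D acc t h1 h2 h3 h4 h5 h6 h7
    simp only [orderIsomorphic_three, cut122]
    split_ifs <;> omega

theorem wordStat_123 (hL : IsBlocks L) (hk : ∀ B ∈ L, 1 ≤ B.1 ∧ B.2 ≤ k) :
    wordStat [1, 2, 3] (blocksWord L) = ∑ x ∈ Finset.Ico 1 (k + 1),
      if L.count (x, x) = 1 ∧ HasBelow L x ∧ HasAbove L x then 1 else 0 := by
  rw [wordStat_eq_scan hL (R := cut123)]
  · refine scan_eq_sum_of_singles hL hk _ _ ?_ ?_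
    · intro acc C t hC
      cases acc <;> cases t <;> simp [cut123]; omega
    intro x acc m t hacc ht hm hlo hhi
    rw [hm, scan_of_boundary (fun B => B = (x, x))]
    · simp only [hhi]
      match m, acc, t with
      | 0, _, _ => simp
      | 1, [], _ => simp [hlo, cut123]
      | 1, B :: acc, [] => simp [cut123]
      | 1, B :: acc, C :: t => simp [hlo, cut123, hacc B, ht C]
      | m + 2, [], t => simp [cut123]
      | m + 2, B :: acc, t => simp [List.replicate_succ, cut123]
    · intro b c acc t hb hc; subst hb hc; cases t <;> simp [cut123]
    · intro c hc; rw [List.eq_of_mem_replicate hc]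
  · intro t; simp [cut123]
  · intro B C acc t h1 h2 h3 h4
    cases t <;> simp only [orderIsomorphic_three, cut123] <;>
    split_ifs <;> omega
  · intro B C acc h1 h2 h3 h4
    simp only [orderIsomorphic_three, cut123]
    split_ifs <;> omega
  · intro B C D acc t h1 h2 h3 h4 h5 h6 h7
    simp only [orderIsomorphic_three, cut123]
    split_ifs <;> omega

theorem wordStat_111 (hL : IsBlocks L) (hk : ∀ B ∈ L, 1 ≤ B.1 ∧ B.2 ≤ k) :
    wordStat [1, 1, 1] (blocksWord L) = ∑ x ∈ Finset.Ico 1 (k + 1), (L.count (x, x) - 2) := by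
  rw [wordStat_eq_scan hL (R := cut111)]
  · refine scan_eq_sum_of_singles hL hk _ _ ?_ ?_
    · intro acc C t hC
      cases acc <;> cases t <;> simp [cut111, Prod.ext_iff]; omega
    intro x acc m t hacc ht hm _ _
    -- Once one singleton `x` stands on the left, every cut in the rest of the run contributes,
    -- except the one before the last singleton.
    have h1 : ∀ (m : ℕ) (acc : List (ℕ × ℕ)),
        scan cut111 ((x, x) :: acc) (List.replicate m (x, x)) t = m - 1 := by
      intro m
      induction m with
      | zero => simp [scan]
      | succ m ih =>
        intro acc
        rw [List.replicate_succ, scan, ih]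
        match m, t with
        | 0, [] => simp [cut111]
        | 0, C :: t =>
          have := ht C (by simp)
          simp [cut111, Prod.ext_iff]; omega
        | m + 1, _ => simp [List.replicate_succ, cut111, add_comm]
    rw [hm]
    match m with
    | 0 => simp [scan]
    | m + 1 =>
      rw [List.replicate_succ, scan, h1]
      match acc with
      | [] => simp [cut111]
      | B :: acc =>
        have := hacc B (by simp)
        cases List.replicate m (x, x) ++ t <;> simp [cut111, Prod.ext_iff]; omega
  · intro t; simp [cut111]
  · intro B C acc t h1 h2 h3 h4
    cases t <;> simp only [orderIsomorphic_three, cut111, Prod.ext_iff] <;>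
    split_ifs <;> omega
  · intro B C acc h1 h2 h3 h4
    simp only [orderIsomorphic_three, cut111]
    split_ifs <;> omega
  · intro B C D acc t h1 h2 h3 h4 h5 h6 h7
    simp only [orderIsomorphic_three, cut111, Prod.ext_iff]
    split_ifs <;> omega

theorem wordStat_112 (hL : IsBlocks L) (hk : ∀ B ∈ L, 1 ≤ B.1 ∧ B.2 ≤ k) :
    wordStat [1, 1, 2] (blocksWord L) = ∑ x ∈ Finset.Ico 1 (k + 1),
      if 2 ≤ L.count (x, x) ∧ HasAbove L x then 1 else 0 := by
  rw [wordStat_eq_scan hL (R := cut112)]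
  · refine scan_eq_sum_of_singles hL hk _ _ ?_ ?_
    · intro acc C t hC
      cases acc <;> cases t <;> simp [cut112, Prod.ext_iff]; omega
    intro x acc m t hacc ht hm _ hhi
    -- The only contributing cut is the one before the last singleton of the run; it needs another
    -- singleton on its left and a block after the run.
    have h1 : ∀ (m : ℕ) (acc : List (ℕ × ℕ)),
        scan cut112 ((x, x) :: acc) (List.replicate m (x, x)) t =
          if 0 < m ∧ t ≠ [] then 1 else 0 := by
      intro m
      induction m with
      | zero => simp [scan]
      | succ m ih =>
        intro acc
        rw [List.replicate_succ, scan, ih]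
        match m, t with
        | 0, [] => simp [cut112]
        | 0, C :: t =>
          have := ht C (by simp)
          simpa [cut112] using this
        | m + 1, _ => simp [List.replicate_succ, cut112]
    rw [hm]
    simp only [hhi]
    match m with
    | 0 => simp [scan]
    | m + 1 =>
      rw [List.replicate_succ, scan, h1]
      match acc with
      | [] => simp [cut112, Nat.succ_le_iff]
      | B :: acc =>
        have h2 : cut112 (B :: acc) ((x, x) :: (List.replicate m (x, x) ++ t)) = 0 := by
          have := hacc B (by simp)
          cases List.replicate m (x, x) ++ t <;> simp [cut112, Prod.ext_iff]; omega
        simp [h2, Nat.succ_le_iff]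
  · intro t; simp [cut112]
  · intro B C acc t h1 h2 h3 h4
    cases t <;> simp only [orderIsomorphic_three, cut112, Prod.ext_iff] <;>
    split_ifs <;> omega
  · intro B C acc h1 h2 h3 h4
    simp only [orderIsomorphic_three, cut112]
    split_ifs <;> omega
  · intro B C D acc t h1 h2 h3 h4 h5 h6 h7
    simp only [orderIsomorphic_three, cut112, Prod.ext_iff]
    split_ifs <;> omega

end Sums

open Step

/-! ### Dispersed Dyck paths, read from left to right -/

/-- A path starting at height `h` that ends on the axis, never goes below it and has its level
steps on it. -/
def ValidFrom : ℕ → List Step → Prop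
  | h, [] => h = 0
  | h, U :: t => ValidFrom (h + 1) t
  | h, D :: t => 1 ≤ h ∧ ValidFrom (h - 1) t
  | h, F :: t => h = 0 ∧ ValidFrom 0 t

theorem height_cons (c : Step) (P : List Step) : height (c :: P) = c.rise + height P := by
  simp [height]

/-- The starting height has to be general for the induction on the path. -/
theorem validFrom_iff (h : ℕ) (P : List Step) : ValidFrom h P ↔
    (h + height P = 0 ∧ (∀ Q, Q <+: P → 0 ≤ h + height Q) ∧
      ∀ Q, Q ++ [F] <+: P → h + height Q = 0) := by
  induction P generalizing h with
  | nil =>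
    simp only [ValidFrom, height, List.map_nil, List.sum_nil, List.prefix_nil]
    constructor
    · rintro rfl; simp
    · rintro ⟨h, -⟩; omega
  | cons c P ih =>
    have key : ∀ g : ℕ, (g : ℤ) = h + c.rise → (ValidFrom g P ↔
        (h + height (c :: P) = 0 ∧ (∀ Q, Q <+: P → 0 ≤ h + height (c :: Q)) ∧
          ∀ Q, Q ++ [F] <+: P → h + height (c :: Q) = 0)) := by
      intro g hg
      simp only [ih, hg, height_cons, add_assoc]
    have e1 : (∀ Q, Q <+: c :: P → 0 ≤ (h : ℤ) + height Q) ↔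
        ∀ Q, Q <+: P → 0 ≤ h + height (c :: Q) := by
      constructor
      · exact fun H Q hQ => H _ (List.cons_prefix_cons.2 ⟨rfl, hQ⟩)
      · intro H Q hQ
        cases Q with
        | nil => simp [height]
        | cons d Q =>
          obtain ⟨rfl, hQ'⟩ := List.cons_prefix_cons.1 hQ
          exact H Q hQ'
    have e2 : (∀ Q, Q ++ [F] <+: c :: P → (h : ℤ) + height Q = 0) ↔
        (c = F → h = 0) ∧ ∀ Q, Q ++ [F] <+: P → h + height (c :: Q) = 0 := by
      constructor
      · refine fun H => ⟨?_, fun Q hQ => H _ (List.cons_prefix_cons.2 ⟨rfl, hQ⟩)⟩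
        rintro rfl
        have := H [] (by simp)
        simpa [height] using this
      · rintro ⟨H1, H⟩ Q hQ
        cases Q with
        | nil =>
          have := (List.cons_prefix_cons.1 hQ).1
          simp [height, H1 this.symm]
        | cons d Q =>
          obtain ⟨rfl, hQ'⟩ := List.cons_prefix_cons.1 hQ
          exact H Q hQ'
    rw [e1, e2]
    cases c with
    | U =>
      rw [ValidFrom, key (h + 1) (by simp [rise])]
      simp
    | D =>
      rw [ValidFrom]
      rcases Nat.eq_zero_or_pos h with rfl | hh
      · simp only [Nat.le_zero, one_ne_zero, false_and, false_iff]
        rintro ⟨-, H, -⟩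
        have := H [] List.nil_prefix
        simp [height, rise] at this
      · rw [key (h - 1) (by simp [rise]; omega)]
        simp; omega
    | F =>
      rw [ValidFrom]
      rcases Nat.eq_zero_or_pos h with rfl | hh
      · rw [key 0 (by simp [rise])]
        simp
      · simp [hh.ne']

theorem isDispersedDyck_iff (P : List Step) : IsDispersedDyck P ↔ ValidFrom 0 P := by
  simp [validFrom_iff, IsDispersedDyck]

/-- The step read backwards. -/
def Step.swap : Step → Step
  | U => D
  | D => U
  | F => F

theorem Step.swap_swap (c : Step) : c.swap.swap = c := by cases c <;> rfl

theorem Step.swap_injective : Function.Injective Step.swap :=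
  Function.LeftInverse.injective (g := Step.swap) Step.swap_swap

/-- The part left of a cut, read backwards with `U` and `D` exchanged, is again a valid path
starting at the height of the cut. Facts about the right part thus apply equally to the left part.
-/
theorem validFrom_move {h : ℕ} {acc l t : List Step} (h1 : ValidFrom h (acc.map swap))
    (h2 : ValidFrom h (l ++ t)) :
    ∃ h', ValidFrom h' ((l.reverse ++ acc).map swap) ∧ ValidFrom h' t := by
  induction l generalizing h acc with
  | nil => exact ⟨h, h1, h2⟩
  | cons c l ih =>
    have : ∃ h', ValidFrom h' ((c :: acc).map swap) ∧ ValidFrom h' (l ++ t) := by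
      cases c with
      | U => exact ⟨h + 1, ⟨by omega, h1⟩, h2⟩
      | D =>
        refine ⟨h - 1, ?_, h2.2⟩
        simp only [List.map_cons, swap, ValidFrom]
        rwa [Nat.sub_add_cancel h2.1]
      | F => obtain ⟨rfl, h2⟩ := h2; exact ⟨0, ⟨rfl, h1⟩, h2⟩
    obtain ⟨h', h3, h4⟩ := this
    simpa using ih h3 h4

theorem scan_congr_of_validFrom {R R' : List Step → List Step → ℕ} {P : List Step}
    (hP : ValidFrom 0 P)
    (h : ∀ a t n, ValidFrom n (a.map swap) → ValidFrom n t → R a t = R' a t) :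
    scan R [] P [] = scan R' [] P [] := by
  refine scan_congr fun a t _ hat => ?_
  simp only [List.reverse_nil, List.nil_append, List.append_nil] at hat
  rw [← hat] at hP
  obtain ⟨n, h1, h2⟩ := validFrom_move (acc := []) (h := 0) rfl hP
  exact h a t n (by simpa using h1) h2

/-! ### Occurrences in terms of cuts -/

/-- The indicator of `z` being a prefix of `t`. -/
def prefixInd (z t : List Step) : ℕ := if z <+: t then 1 else 0

theorem prefixInd_cons_cons (c d : Step) (z t : List Step) :
    prefixInd (c :: z) (d :: t) = if c = d then prefixInd z t else 0 := by
  unfold prefixInd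
  by_cases h : c = d <;> simp [List.cons_prefix_cons, h]

@[simp] theorem prefixInd_nil_left (t : List Step) : prefixInd [] t = 1 := by simp [prefixInd]

@[simp] theorem prefixInd_cons_nil (c : Step) (z : List Step) : prefixInd (c :: z) [] = 0 := by
  simp [prefixInd]

theorem occ_cons (p : List Step) (c : Step) (P : List Step) :
    occ p (c :: P) = prefixInd p (c :: P) + occ p P := by
  simp [occ, List.countP_cons, prefixInd, add_comm]

/-- Each occurrence is located by the cut between `y` and `z`; letters pass from `z` to `y` by
`scan_shift`. The assumption `z ≠ []` is essential because a scan omits the final cut. -/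
theorem occ_append_eq_scan (y : List Step) {z : List Step} (hz : z ≠ []) (P : List Step) :
    occ (y ++ z) P =
      scan (fun a t => prefixInd (y.reverse.map swap) (a.map swap) * prefixInd z t) [] P [] := by
  induction y using List.reverseRecOn generalizing z with
  | nil =>
    have : ∀ acc, occ z P = scan (fun a t => prefixInd ([].reverse.map swap) (a.map swap) *
        prefixInd z t) acc P [] := by
      induction P with
      | nil => intro acc; simp [occ, scan, hz]
      | cons c P ih => intro acc; rw [scan, occ_cons, ih (c :: acc)]; simp
    exact this []
  | append_singleton y c ih =>
    rw [List.append_assoc, List.singleton_append, ih (by simp)]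
    have hs := scan_shift (R := fun a t => prefixInd (y.reverse.map swap) (a.map swap) *
        prefixInd (c :: z) t)
      (R' := fun a t => prefixInd ((y ++ [c]).reverse.map swap) (a.map swap) * prefixInd z t)
      (fun acc => by simp [prefixInd, hz]) (fun d acc t => by
        simp only [prefixInd, List.reverse_append, List.reverse_cons, List.reverse_nil,
          List.nil_append, List.singleton_append, List.map_cons, List.cons_prefix_cons,
          Step.swap_injective.eq_iff]
        split_ifs <;> simp_all) [] P
    rw [← hs]
    simp [prefixInd]

/-! ### Sums over powers of `UD` -/

@[simp] theorem ud_zero : ud 0 = [] := rfl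

theorem ud_succ (i : ℕ) : ud (i + 1) = U :: D :: ud i := by
  simp [ud, List.replicate_succ]

theorem ud_succ' (i : ℕ) : ud (i + 1) = ud i ++ [U, D] := by
  simp [ud, List.replicate_succ']

theorem map_swap_reverse_ud (i : ℕ) : (ud i).reverse.map swap = ud i := by
  induction i with
  | zero => simp
  | succ i ih =>
    rw [ud_succ]
    simp only [List.reverse_cons, List.map_append, ih, List.map_cons, List.map_nil, swap,
      List.append_assoc]
    rw [← ud_succ, ud_succ']
    rfl

/-- Removal of the leading peaks of a path. -/
def stripPeaks : List Step → List Step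
  | U :: D :: t => stripPeaks t
  | t => t

theorem stripPeaks_peak (t : List Step) : stripPeaks (U :: D :: t) = stripPeaks t := by
  rw [stripPeaks]

theorem stripPeaks_of_ne {t : List Step} (ht : ∀ u, t ≠ U :: D :: u) : stripPeaks t = t := by
  rw [stripPeaks]
  exact ht

theorem prefixInd_ud_succ_append_of_ne {t : List Step} (ht : ∀ u, t ≠ U :: D :: u) (i : ℕ)
    (z : List Step) : prefixInd (ud (i + 1) ++ z) t = 0 := by
  rw [prefixInd, if_neg]
  rintro ⟨u, rfl⟩
  exact ht (ud i ++ z ++ u) (by simp [ud_succ])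

theorem prefixInd_ud_succ_append_peak (i : ℕ) (z t : List Step) :
    prefixInd (ud (i + 1) ++ z) (U :: D :: t) = prefixInd (ud i ++ z) t := by
  simp [ud_succ, prefixInd_cons_cons]

/-- Since `z` cannot begin at a peak, at most one power `i` fits, namely the number of leading peaks
of `t`; the bound on the length puts it in the range. -/
theorem sum_range_prefixInd_ud {z : List Step} (hz : ∀ t, ¬ z <+: U :: D :: t) {N : ℕ}
    {t : List Step} (ht : t.length ≤ N) :
    ∑ i ∈ Finset.range (N + 1), prefixInd (ud i ++ z) t = prefixInd z (stripPeaks t) := by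
  induction N generalizing t with
  | zero =>
    have : t = [] := List.eq_nil_of_length_eq_zero (by omega)
    subst this
    simp [stripPeaks]
  | succ N ih =>
    rw [Finset.sum_range_succ']
    by_cases h : ∃ u, t = U :: D :: u
    · obtain ⟨u, rfl⟩ := h
      rw [stripPeaks_peak, ← ih (t := u) (by simp at ht; omega)]
      simp only [prefixInd_ud_succ_append_peak]
      simp [prefixInd, hz]
    · push Not at h
      simp [stripPeaks_of_ne h, prefixInd_ud_succ_append_of_ne h]

theorem sum_Icc_prefixInd_ud {z : List Step} (hz : ∀ t, ¬ z <+: U :: D :: t) {N : ℕ}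
    {t : List Step} (ht : t.length ≤ N) :
    ∑ i ∈ Finset.Icc 1 N, prefixInd (ud i ++ z) t =
      prefixInd [U, D] t * prefixInd z (stripPeaks t) := by
  have h1 : ∑ i ∈ Finset.Icc 1 N, prefixInd (ud i ++ z) t =
      ∑ i ∈ Finset.range N, prefixInd (ud (i + 1) ++ z) t := by
    rw [Finset.range_eq_Ico, Finset.sum_Ico_add' (fun i => prefixInd (ud i ++ z) t)]
    rfl
  rw [h1]
  by_cases h : ∃ u, t = U :: D :: u
  · obtain ⟨u, rfl⟩ := h
    obtain ⟨N, rfl⟩ : ∃ N', N = N' + 1 := ⟨N - 1, by simp at ht; omega⟩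
    simp only [prefixInd_ud_succ_append_peak]
    rw [sum_range_prefixInd_ud hz (by simp at ht; omega), stripPeaks_peak]
    simp [prefixInd_cons_cons]
  · push Not at h
    have : prefixInd [U, D] t = 0 := by
      rw [prefixInd, if_neg]
      rintro ⟨u, rfl⟩
      exact h u rfl
    simp [this, prefixInd_ud_succ_append_of_ne h]

/-- The indicator of `(UD)^*Z` being readable at the beginning of a path. -/
def starInd (z t : List Step) : ℕ := prefixInd z (stripPeaks t)

/-- The indicator of `(UD)^+Z` being readable at the beginning of a path. -/
def plusInd (z t : List Step) : ℕ := prefixInd [U, D] t * prefixInd z (stripPeaks t)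

section Stats

variable {Y Z : List Step} (P : List Step)

theorem starStat_right (hZ0 : Z ≠ []) (hZ : ∀ t, ¬ Z <+: U :: D :: t) :
    starStat (fun i => occ (Y ++ ud i ++ Z)) P =
      scan (fun a t => prefixInd (Y.reverse.map swap) (a.map swap) * starInd Z t) [] P [] := by
  simp only [starStat, List.append_assoc, occ_append_eq_scan Y (z := ud _ ++ Z) (by simp [hZ0])]
  rw [← scan_sum]
  refine scan_congr fun a t _ hat => ?_
  rw [← Finset.mul_sum, sum_range_prefixInd_ud hZ, starInd]
  have := congrArg List.length hat
  simp at this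
  omega

theorem plusStat_right (hZ0 : Z ≠ []) (hZ : ∀ t, ¬ Z <+: U :: D :: t) :
    plusStat (fun i => occ (Y ++ ud i ++ Z)) P =
      scan (fun a t => prefixInd (Y.reverse.map swap) (a.map swap) * plusInd Z t) [] P [] := by
  simp only [plusStat, List.append_assoc, occ_append_eq_scan Y (z := ud _ ++ Z) (by simp [hZ0])]
  rw [← scan_sum]
  refine scan_congr fun a t _ hat => ?_
  rw [← Finset.mul_sum, sum_Icc_prefixInd_ud hZ, plusInd]
  have := congrArg List.length hat
  simp at this
  omega

theorem starStat_left (hZ0 : Z ≠ []) (hY : ∀ t, ¬ Y.reverse.map swap <+: U :: D :: t) :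
    starStat (fun i => occ (Y ++ ud i ++ Z)) P =
      scan (fun a t => starInd (Y.reverse.map swap) (a.map swap) * prefixInd Z t) [] P [] := by
  simp only [starStat, occ_append_eq_scan _ hZ0]
  rw [← scan_sum]
  refine scan_congr fun a t _ hat => ?_
  simp only [List.reverse_append, List.map_append, map_swap_reverse_ud]
  rw [← Finset.sum_mul, sum_range_prefixInd_ud hY, starInd]
  have := congrArg List.length hat
  simp at this
  simp
  omega

theorem plusStat_left (hZ0 : Z ≠ []) (hY : ∀ t, ¬ Y.reverse.map swap <+: U :: D :: t) :
    plusStat (fun i => occ (Y ++ ud i ++ Z)) P =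
      scan (fun a t => plusInd (Y.reverse.map swap) (a.map swap) * prefixInd Z t) [] P [] := by
  simp only [plusStat, occ_append_eq_scan _ hZ0]
  rw [← scan_sum]
  refine scan_congr fun a t _ hat => ?_
  simp only [List.reverse_append, List.map_append, map_swap_reverse_ud]
  rw [← Finset.sum_mul, sum_Icc_prefixInd_ud hY, plusInd]
  have := congrArg List.length hat
  simp at this
  simp
  omega

/-- The cut is placed just before the middle `F`, which makes the sums over the two powers
independent factors. -/
theorem sum_sum_occ (I J : Finset ℕ) (Y Z : List Step) :
    ∑ i ∈ I, ∑ j ∈ J, occ (Y ++ ud i ++ [F] ++ ud j ++ Z) P =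
      scan (fun a t => (∑ i ∈ I, prefixInd (ud i ++ Y.reverse.map swap) (a.map swap)) *
        (prefixInd [F] t * ∑ j ∈ J, prefixInd (ud j ++ Z) t.tail)) [] P [] := by
  have h : ∀ i j, occ (Y ++ ud i ++ [F] ++ ud j ++ Z) P =
      scan (fun a t => prefixInd (ud i ++ Y.reverse.map swap) (a.map swap) *
        (prefixInd [F] t * prefixInd (ud j ++ Z) t.tail)) [] P [] := by
    intro i j
    rw [show Y ++ ud i ++ [F] ++ ud j ++ Z = (Y ++ ud i) ++ (F :: (ud j ++ Z)) by simp,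
      occ_append_eq_scan _ (by simp)]
    refine scan_congr fun a t _ _ => ?_
    simp only [List.reverse_append, List.map_append, map_swap_reverse_ud]
    congr 1
    cases t with
    | nil => simp
    | cons c t => simp [prefixInd_cons_cons]
  simp only [h, ← scan_sum]
  refine scan_congr fun a t _ _ => ?_
  rw [Finset.sum_mul]
  refine Finset.sum_congr rfl fun i _ => ?_
  rw [Finset.mul_sum, Finset.mul_sum]

variable {P}

theorem length_le_of_cut {a t : List Step} (h : a.reverse ++ t = [].reverse ++ P ++ []) :
    (a.map swap).length ≤ P.length ∧ t.tail.length ≤ P.length := by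
  have := congrArg List.length h
  simp at this ⊢
  omega

variable (P)

/-- The four statistics are the terms of a product: one factor offers two alternatives to the left
of `F`, the other two to its right. -/
theorem sum_starStat_plusStat_F {Y₁ Y₂ Z₁ Z₂ : List Step}
    (hY₁ : ∀ t, ¬ Y₁.reverse.map swap <+: U :: D :: t)
    (hY₂ : ∀ t, ¬ Y₂.reverse.map swap <+: U :: D :: t)
    (hZ₁ : ∀ t, ¬ Z₁ <+: U :: D :: t) (hZ₂ : ∀ t, ¬ Z₂ <+: U :: D :: t) :
    starStat (fun i => starStat fun j => occ (Y₁ ++ ud i ++ [F] ++ ud j ++ Z₁)) P +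
      starStat (fun i => plusStat fun j => occ (Y₁ ++ ud i ++ [F] ++ ud j ++ Z₂)) P +
      plusStat (fun i => starStat fun j => occ (Y₂ ++ ud i ++ [F] ++ ud j ++ Z₁)) P +
      plusStat (fun i => plusStat fun j => occ (Y₂ ++ ud i ++ [F] ++ ud j ++ Z₂)) P =
    scan (fun a t => (plusInd (Y₂.reverse.map swap) (a.map swap) +
        starInd (Y₁.reverse.map swap) (a.map swap)) *
      (prefixInd [F] t * (plusInd Z₂ t.tail + starInd Z₁ t.tail))) [] P [] := by
  simp only [starStat, plusStat, sum_sum_occ, ← scan_add]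
  refine scan_congr fun a t _ hat => ?_
  obtain ⟨h1, h2⟩ := length_le_of_cut hat
  rw [sum_range_prefixInd_ud hY₁ h1, sum_range_prefixInd_ud hZ₁ h2, sum_Icc_prefixInd_ud hY₂ h1,
    sum_Icc_prefixInd_ud hZ₂ h2]
  simp only [plusInd, starInd]
  ring

end Stats

/-! ### Collapsing the star and plus statistics -/

/-- The indicator of a path that begins with an up step and is not of the form `(UD)^*`. -/
def riseInd (t : List Step) : ℕ := if t.head? = some U ∧ stripPeaks t ≠ [] then 1 else 0

theorem stripPeaks_cases {h : ℕ} {t : List Step} (ht : ValidFrom h t) :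
    stripPeaks t = [] ∨ (h = 0 ∧ ∃ u, stripPeaks t = F :: u) ∨
      (0 < h ∧ ∃ u, stripPeaks t = D :: u) ∨ ∃ u, stripPeaks t = U :: U :: u := by
  match t, ht with
  | [], _ => exact Or.inl rfl
  | [U], ht => simp [ValidFrom] at ht
  | U :: F :: t, ht => simp [ValidFrom] at ht
  | U :: U :: t, _ => exact Or.inr (Or.inr (Or.inr ⟨t, rfl⟩))
  | U :: D :: t, ht =>
    rw [stripPeaks_peak]
    exact stripPeaks_cases ht.2
  | D :: t, ht => exact Or.inr (Or.inr (Or.inl ⟨ht.1, t, rfl⟩))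
  | F :: t, ht => exact Or.inr (Or.inl ⟨ht.1, t, rfl⟩)

/-- The three terms are the exclusive ways for a valid path to begin with `U` without being a power
of `UD`. For `F` and `D` a leading peak is required, as otherwise the path would not begin with `U`;
for `UU` it is optional. -/
theorem plusInd_add_plusInd_add_starInd {h : ℕ} {t : List Step} (ht : ValidFrom h t) :
    plusInd [F] t + plusInd [D] t + starInd [U, U] t = riseInd t := by
  have hc := stripPeaks_cases ht
  by_cases hp : ∃ u, t = U :: D :: u
  · obtain ⟨u, rfl⟩ := hp
    rcases hc with hc | ⟨-, u, hc⟩ | ⟨-, u, hc⟩ | ⟨u, hc⟩ <;>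
      simp [plusInd, starInd, riseInd, hc, prefixInd_cons_cons]
  · push Not at hp
    have h0 : prefixInd [U, D] t = 0 := by
      rw [prefixInd, if_neg]
      rintro ⟨u, rfl⟩
      exact hp u rfl
    rw [stripPeaks_of_ne hp] at hc
    rcases hc with rfl | ⟨-, u, rfl⟩ | ⟨-, u, rfl⟩ | ⟨u, rfl⟩ <;>
      simp [plusInd, starInd, riseInd, prefixInd_cons_cons, stripPeaks]

/-- Stripping peaks does not change the height, so at height zero the remainder cannot begin with
`D`. -/
theorem plusInd_add_starInd {t : List Step} (ht : ValidFrom 0 t) :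
    plusInd [F] t + starInd [U, U] t = riseInd t := by
  rw [← plusInd_add_plusInd_add_starInd ht]
  have : prefixInd [D] (stripPeaks t) = 0 := by
    rcases stripPeaks_cases ht with hc | ⟨-, u, hc⟩ | ⟨h, -⟩ | ⟨u, hc⟩
    · simp [hc]
    · simp [hc, prefixInd_cons_cons]
    · omega
    · simp [hc, prefixInd_cons_cons]
  simp [plusInd, this]

theorem not_F_prefix (z t : List Step) : ¬ F :: z <+: U :: D :: t := by
  simp [List.cons_prefix_cons]

theorem not_D_prefix (z t : List Step) : ¬ D :: z <+: U :: D :: t := by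
  simp [List.cons_prefix_cons]

theorem not_UU_prefix (z t : List Step) : ¬ U :: U :: z <+: U :: D :: t := by
  simp [List.cons_prefix_cons]

theorem ValidFrom.eq_zero_of_prefixInd_ne {h : ℕ} {z t : List Step} (ht : ValidFrom h t)
    (hz : prefixInd (F :: z) t ≠ 0) : h = 0 := by
  cases t with
  | nil => simp at hz
  | cons c t =>
    rw [prefixInd_cons_cons] at hz
    by_cases hc : F = c
    · subst hc
      exact ht.1
    · simp [hc] at hz

section Formulas

variable {P : List Step}

theorem pathStat_112 (hP : ValidFrom 0 P) :
    plusStat (fun i => occ ([F, F] ++ ud i ++ [F])) P +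
      starStat (fun i => occ ([F, F] ++ ud i ++ [U, U])) P =
    scan (fun a t => prefixInd [F, F] (a.map swap) * riseInd t) [] P [] := by
  rw [plusStat_right _ (by simp) (not_F_prefix _), starStat_right _ (by simp) (not_UU_prefix _),
    ← scan_add]
  refine scan_congr_of_validFrom hP fun a t n h1 h2 => ?_
  simp only [List.reverse_cons, List.reverse_nil, List.nil_append, List.map_cons,
    List.map_nil, List.cons_append, swap]
  rw [← mul_add]
  -- A level step next to the cut forces height zero, which removes the `D` alternative.
  by_cases h0 : prefixInd [F, F] (a.map swap) = 0
  · simp [h0]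
  · obtain rfl := h1.eq_zero_of_prefixInd_ne h0
    rw [plusInd_add_starInd h2]

theorem pathStat_122 (hP : ValidFrom 0 P) :
    plusStat (fun i => occ ([F] ++ ud i ++ [F, F])) P +
      starStat (fun i => occ ([D, D] ++ ud i ++ [F, F])) P =
    scan (fun a t => riseInd (a.map swap) * prefixInd [F, F] t) [] P [] := by
  rw [plusStat_left _ (Y := [F]) (by simp) (not_F_prefix _), starStat_left _ (Y := [D, D]) (by simp) (not_UU_prefix _),
    ← scan_add]
  refine scan_congr_of_validFrom hP fun a t n h1 h2 => ?_
  simp only [List.reverse_cons, List.reverse_nil, List.nil_append, List.map_cons,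
    List.map_nil, List.cons_append, swap]
  rw [← add_mul]
  by_cases h0 : prefixInd [F, F] t = 0
  · simp [h0]
  · obtain rfl := h2.eq_zero_of_prefixInd_ne h0
    rw [plusInd_add_starInd h1]

theorem pathStat_132 (hP : ValidFrom 0 P) :
    plusStat (fun i => occ ([F] ++ ud i ++ [U, U])) P +
      plusStat (fun i => occ ([U] ++ ud i ++ [U, U])) P +
      starStat (fun i => occ ([D, D] ++ ud i ++ [U, U])) P =
    scan (fun a t => riseInd (a.map swap) * prefixInd [U, U] t) [] P [] := by
  rw [plusStat_left _ (Y := [F]) (by simp) (not_F_prefix _), plusStat_left _ (Y := [U]) (by simp) (not_D_prefix _),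
    starStat_left _ (Y := [D, D]) (by simp) (not_UU_prefix _), ← scan_add, ← scan_add]
  refine scan_congr_of_validFrom hP fun a t n h1 h2 => ?_
  simp only [List.reverse_cons, List.reverse_nil, List.nil_append, List.map_cons,
    List.map_nil, List.cons_append, swap]
  rw [← add_mul, ← add_mul, plusInd_add_plusInd_add_starInd h1]

theorem pathStat_213 (hP : ValidFrom 0 P) :
    plusStat (fun i => occ ([D, D] ++ ud i ++ [F])) P +
      plusStat (fun i => occ ([D, D] ++ ud i ++ [D])) P +
      starStat (fun i => occ ([D, D] ++ ud i ++ [U, U])) P =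
    scan (fun a t => prefixInd [U, U] (a.map swap) * riseInd t) [] P [] := by
  rw [plusStat_right _ (by simp) (not_F_prefix _), plusStat_right _ (by simp) (not_D_prefix _),
    starStat_right _ (by simp) (not_UU_prefix _), ← scan_add, ← scan_add]
  refine scan_congr_of_validFrom hP fun a t n h1 h2 => ?_
  simp only [List.reverse_cons, List.reverse_nil, List.nil_append, List.map_cons,
    List.map_nil, List.cons_append, swap]
  rw [← mul_add, ← mul_add, plusInd_add_plusInd_add_starInd h2]

theorem pathStat_123 (hP : ValidFrom 0 P) :
    starStat (fun i => starStat fun j => occ ([D, D] ++ ud i ++ [F] ++ ud j ++ [U, U])) P +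
      starStat (fun i => plusStat fun j => occ ([D, D] ++ ud i ++ [F] ++ ud j ++ [F])) P +
      plusStat (fun i => starStat fun j => occ ([F] ++ ud i ++ [F] ++ ud j ++ [U, U])) P +
      plusStat (fun i => plusStat fun j => occ ([F] ++ ud i ++ [F] ++ ud j ++ [F])) P =
    scan (fun a t => riseInd (a.map swap) * (prefixInd [F] t * riseInd t.tail)) [] P [] := by
  rw [sum_starStat_plusStat_F P (Y₁ := [D, D]) (Y₂ := [F]) (not_UU_prefix _) (not_F_prefix _)
    (not_UU_prefix _) (not_F_prefix _)]
  refine scan_congr_of_validFrom hP fun a t n h1 h2 => ?_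
  simp only [List.reverse_cons, List.reverse_nil, List.nil_append, List.map_cons,
    List.map_nil, List.cons_append, swap]
  by_cases h0 : prefixInd [F] t = 0
  · simp [h0]
  -- The middle `F` puts both of its ends on the axis, so the two-term collapse applies on either
  -- side.
  · obtain rfl := h2.eq_zero_of_prefixInd_ne h0
    rw [plusInd_add_starInd h1]
    cases t with
    | nil => simp at h0
    | cons c t =>
      rw [prefixInd_cons_cons] at h0
      by_cases hc : F = c
      · subst hc
        rw [List.tail_cons, plusInd_add_starInd h2.2]
      · simp [hc] at h0

end Formulas

/-! ### Paths given by the lengths of their runs -/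

/-- The path
`F^{s(x)} U^{1+q(x)} D^{1+p(x+1)} F^{s(x+1)} ⋯ U^{1+q(x+m-1)} D^{1+p(x+m)} F^{s(x+m)}`. -/
def runsPath (s q p : ℕ → ℕ) : ℕ → ℕ → List Step
  | x, 0 => List.replicate (s x) F
  | x, m + 1 => List.replicate (s x) F ++ (List.replicate (1 + q x) U ++
      (List.replicate (1 + p (x + 1)) D ++ runsPath s q p (x + 1) m))

theorem faroPath_eq_runsPath (k : ℕ) (w : List ℕ) :
    faroPath k w = runsPath (singletons w) (pairsWithSecond w) (pairsWithFirst w) 1 (k - 1) := by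
  have : ∀ m x, List.replicate (singletons w x) F ++ ((List.range' x m).flatMap fun x =>
      List.replicate (1 + pairsWithSecond w x) U ++
        List.replicate (1 + pairsWithFirst w (x + 1)) D ++
          List.replicate (singletons w (x + 1)) F) =
      runsPath (singletons w) (pairsWithSecond w) (pairsWithFirst w) x m := by
    intro m
    induction m with
    | zero => simp [runsPath]
    | succ m ih =>
      intro x
      rw [runsPath, ← ih]
      simp [List.range'_succ]
  exact this _ _

theorem head?_runsPath_ne_D (s q p : ℕ → ℕ) (x m : ℕ) : (runsPath s q p x m).head? ≠ some D := by
  cases h : s x <;> cases m <;>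
    simp [runsPath, h, List.replicate_succ, Nat.add_comm 1]

theorem stripPeaks_runs_eq_nil_iff (a b c : ℕ) (t : List Step) :
    stripPeaks (List.replicate (1 + a) U ++ (List.replicate (1 + b) D ++
      (List.replicate c F ++ t))) = [] ↔ a = 0 ∧ b = 0 ∧ c = 0 ∧ stripPeaks t = [] := by
  match a, b, c with
  | 0, 0, 0 => simp [stripPeaks_peak]
  | 0, 0, c + 1 => simp [stripPeaks_peak, List.replicate_succ, stripPeaks]
  | 0, b + 1, c => simp [stripPeaks_peak, List.replicate_succ, Nat.add_comm 1, stripPeaks]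
  | a + 1, b, c =>
    rw [stripPeaks_of_ne] <;> simp [List.replicate_succ, Nat.add_comm 1]

/-- The facts about the part of a path to the left of `F^{s(x)}` on which the statistics depend. -/
structure LeftContext (px : ℕ) (lo : Prop) (acc : List Step) : Prop where
  head : acc = [] ∨ acc.head? = some D
  pairs : [D, D] <+: acc ↔ 0 < px
  strip : stripPeaks (acc.map swap) ≠ [] ↔ lo

/-- The facts about the part of a path to the right of `F^{s(x)}` on which the statistics depend. -/
structure RightContext (hi : Prop) (t : List Step) : Prop where
  head : t = [] ∨ t.head? = some U
  strip : stripPeaks t ≠ [] ↔ hi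

theorem scan_eq_zero_of_forall {R : List Step → List Step → ℕ} {c : Step}
    (h : ∀ a t, R a (c :: t) = 0) (m : ℕ) (acc t : List Step) :
    scan R acc (List.replicate m c) t = 0 := by
  induction m generalizing acc with
  | zero => simp [scan]
  | succ m ih => rw [List.replicate_succ, scan, h, ih]

/-- Numbers of singletons, of pairs by smaller and by larger letter, and the letters `x` such that
there are blocks with a letter smaller or larger than `x`, for letters in `[1, k]`. -/
structure RunData (k : ℕ) (s q p : ℕ → ℕ) (lo hi : ℕ → Prop) : Prop where
  p_one : p 1 = 0
  q_last : q k = 0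
  lo_one : ¬ lo 1
  hi_last : ¬ hi k
  lo_succ : ∀ x, lo (x + 1) ↔ 0 < q x ∨ 0 < p (x + 1) ∨ 0 < s x ∨ lo x
  hi_eq : ∀ x, hi x ↔ 0 < q x ∨ 0 < p (x + 1) ∨ 0 < s (x + 1) ∨ hi (x + 1)

/-- The functions `f`, `g`, `e` give the contributions of the runs of `F`, `U` and `D`. The last
letter has no run of `U`, hence `g k = 0`; the first has no run of `D`, hence the sum of `e` starts
at `2`. -/
theorem scan_runsPath {k : ℕ} {s q p : ℕ → ℕ} {lo hi : ℕ → Prop} (hd : RunData k s q p lo hi)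
    (hk : 1 ≤ k) (R : List Step → List Step → ℕ) (f g e : ℕ → ℕ) (hg : g k = 0)
    (hF : ∀ x acc t, LeftContext (p x) (lo x) acc → RightContext (hi x) t →
      scan R acc (List.replicate (s x) F) t = f x)
    (hU : ∀ x acc t, LeftContext (p x) (lo x) acc →
      RightContext (hi x) (List.replicate (1 + q x) U ++ D :: t) →
      scan R (List.replicate (s x) F ++ acc) (List.replicate (1 + q x) U) (D :: t) = g x)
    (hD : ∀ x acc t, t.head? ≠ some D →
      scan R (U :: acc) (List.replicate (1 + p x) D) t = e x) :
    scan R [] (runsPath s q p 1 (k - 1)) [] =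
      ∑ x ∈ Finset.Ico 1 (k + 1), f x + ∑ x ∈ Finset.Ico 1 (k + 1), g x +
        ∑ x ∈ Finset.Ico 2 (k + 1), e x := by
  -- The right context is built from the end of the path by `hi_eq`, whereas the left context is
  -- carried along the scan by `lo_succ`. In both cases `stripPeaks_runs_eq_nil_iff` matches the
  -- recurrence.
  have right : ∀ m x, x + m = k → RightContext (hi x) ((runsPath s q p x m).drop (s x)) := by
    intro m
    induction m with
    | zero =>
      rintro x rfl
      have := hd.hi_last
      exact ⟨by simp [runsPath], by simpa [runsPath, stripPeaks] using this⟩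
    | succ m ih =>
      intro x hx
      have ih := ih (x + 1) (by omega)
      have hrun : ∀ m x, runsPath s q p x m =
          List.replicate (s x) F ++ (runsPath s q p x m).drop (s x) := by
        intro m x
        cases m <;> simp [runsPath]
      have e : (runsPath s q p x (m + 1)).drop (s x) = List.replicate (1 + q x) U ++
          (List.replicate (1 + p (x + 1)) D ++ (List.replicate (s (x + 1)) F ++
            (runsPath s q p (x + 1) m).drop (s (x + 1)))) := by
        rw [← hrun]
        simp [runsPath]
      rw [e]
      refine ⟨Or.inr (by simp [List.replicate_succ, Nat.add_comm 1]), ?_⟩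
      rw [Ne, stripPeaks_runs_eq_nil_iff, hd.hi_eq x, ← ih.strip]
      simp only [Nat.pos_iff_ne_zero]
      tauto
  have key : ∀ m x acc, x + m = k → LeftContext (p x) (lo x) acc →
      scan R acc (runsPath s q p x m) [] =
        ∑ y ∈ Finset.Ico x (k + 1), f y + ∑ y ∈ Finset.Ico x (k + 1), g y +
          ∑ y ∈ Finset.Ico (x + 1) (k + 1), e y := by
    intro m
    induction m with
    | zero =>
      intro x acc hx hacc
      obtain rfl : x = k := by omega
      have h := right 0 x rfl
      simp only [runsPath, List.drop_replicate, Nat.sub_self, List.replicate_zero] at h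
      simp [runsPath, hF x acc [] hacc h, hg]
    | succ m ih =>
      intro x acc hx hacc
      have hr := right (m + 1) x hx
      simp only [runsPath, List.drop_left' List.length_replicate] at hr
      have hacc' : LeftContext (p (x + 1)) (lo (x + 1))
          (List.replicate (1 + p (x + 1)) D ++ (List.replicate (1 + q x) U ++
            (List.replicate (s x) F ++ acc))) := by
        refine ⟨Or.inr (by simp [List.replicate_succ, Nat.add_comm 1]), ?_, ?_⟩
        · cases p (x + 1) <;> simp [List.replicate_succ, Nat.add_comm 1, List.cons_prefix_cons]
        · simp only [List.map_append, List.map_replicate, swap]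
          rw [Ne, stripPeaks_runs_eq_nil_iff, hd.lo_succ x, ← hacc.strip]
          simp only [Nat.pos_iff_ne_zero]
          tauto
      have h1 := hU x acc (List.replicate (p (x + 1)) D ++ runsPath s q p (x + 1) m) hacc (by
        simpa [List.replicate_succ, Nat.add_comm 1] using hr)
      have h2 := hD (x + 1) (List.replicate (q x) U ++ (List.replicate (s x) F ++ acc)) _
        (head?_runsPath_ne_D s q p (x + 1) m)
      have h3 := hF x acc _ hacc hr
      rw [Finset.sum_eq_sum_Ico_succ_bot (by omega) f, Finset.sum_eq_sum_Ico_succ_bot (by omega) g,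
        Finset.sum_eq_sum_Ico_succ_bot (a := x + 1) (by omega) e, runsPath, scan_append,
        scan_append, scan_append]
      simp only [List.append_nil, List.reverse_replicate]
      rw [ih (x + 1) _ (by omega) hacc', h3]
      have e1 : List.replicate (1 + p (x + 1)) D ++ runsPath s q p (x + 1) m =
          D :: (List.replicate (p (x + 1)) D ++ runsPath s q p (x + 1) m) := by
        simp [List.replicate_succ, Nat.add_comm 1]
      have e2 : List.replicate (1 + q x) U ++ (List.replicate (s x) F ++ acc) =
          U :: (List.replicate (q x) U ++ (List.replicate (s x) F ++ acc)) := by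
        simp [List.replicate_succ, Nat.add_comm 1]
      rw [e1, h1, e2, h2]
      ring
  refine key (k - 1) 1 [] (by omega) ⟨Or.inl rfl, ?_, ?_⟩
  · simp [hd.p_one]
  · simp [hd.lo_one, stripPeaks]

/-! ### Path statistics as sums over the letters -/

section Formulas

variable {k : ℕ} {s q p : ℕ → ℕ} {lo hi : ℕ → Prop}

theorem riseInd_left [∀ x, Decidable (lo x)] {px x : ℕ} {acc : List Step}
    (h : LeftContext px (lo x) acc) :
    riseInd (acc.map swap) = if lo x then 1 else 0 := by
  unfold riseInd
  refine if_congr ?_ rfl rfl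
  rw [← h.strip]
  rcases h.head with rfl | h'
  · simp [stripPeaks]
  · cases acc <;> simp at h'; simp [h', swap]

theorem riseInd_right [∀ x, Decidable (hi x)] {x : ℕ} {t : List Step}
    (h : RightContext (hi x) t) :
    riseInd t = if hi x then 1 else 0 := by
  unfold riseInd
  refine if_congr ?_ rfl rfl
  rw [← h.strip]
  rcases h.head with rfl | h'
  · simp [stripPeaks]
  · simp [h']

theorem prefixInd_left {px : ℕ} {lox : Prop} {acc : List Step} (h : LeftContext px lox acc) :
    prefixInd [U, U] (acc.map swap) = if 0 < px then 1 else 0 := by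
  unfold prefixInd
  refine if_congr ?_ rfl rfl
  rw [← h.pairs]
  match acc with
  | [] => simp
  | [a] => cases a <;> simp [List.cons_prefix_cons, swap]
  | a :: b :: t => cases a <;> cases b <;> simp [List.cons_prefix_cons, swap]

theorem sum_112 [∀ x, Decidable (hi x)] (hd : RunData k s q p lo hi)
    (hk : 1 ≤ k) :
    scan (fun a t => prefixInd [F, F] (a.map swap) * riseInd t) [] (runsPath s q p 1 (k - 1)) [] =
      ∑ x ∈ Finset.Ico 1 (k + 1), if 2 ≤ s x ∧ hi x then 1 else 0 := by
  rw [scan_runsPath hd hk _ (fun _ => 0) (fun x => if 2 ≤ s x ∧ hi x then 1 else 0) (fun _ => 0)]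
  · simp
  · simp [hd.hi_last]
  · intro x acc t _ _
    exact scan_eq_zero_of_forall (by simp [riseInd]) _ _ _
  · intro x acc t hl hr
    -- Only the cut at the start of the run of `U` can have `FF` on its left. What precedes
    -- `F^{s(x)}` is empty or ends with `D`, so this requires `s x ≥ 2`.
    rw [scan_of_boundary (fun c => c = U), riseInd_right hr]
    · match s x, acc, hl.head with
      | 0, [], _ => simp
      | 0, c :: acc, h => simp at h; simp [prefixInd_cons_cons, h, swap]
      | 1, [], _ => simp [prefixInd_cons_cons, swap]
      | 1, c :: acc, h => simp at h; simp [prefixInd_cons_cons, h, swap]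
      | s + 2, acc, _ => simp [prefixInd_cons_cons, List.replicate_succ, swap]
    · rintro b c acc t rfl rfl
      simp [prefixInd_cons_cons, swap]
    · simp
  · intro x acc t _
    exact scan_eq_zero_of_forall (by simp [riseInd]) _ _ _

theorem sum_122 [∀ x, Decidable (lo x)] (hd : RunData k s q p lo hi)
    (hk : 1 ≤ k) :
    scan (fun a t => riseInd (a.map swap) * prefixInd [F, F] t) [] (runsPath s q p 1 (k - 1)) [] =
      ∑ x ∈ Finset.Ico 1 (k + 1), if 2 ≤ s x ∧ lo x then 1 else 0 := by
  rw [scan_runsPath hd hk _ (fun x => if 2 ≤ s x ∧ lo x then 1 else 0) (fun _ => 0) (fun _ => 0)]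
  · simp
  · rfl
  · intro x acc t hl hr
    rw [scan_of_boundary (fun c => c = F), riseInd_left hl]
    · match s x, t, hr.head with
      | 0, _, _ => simp
      | 1, [], _ => simp [prefixInd_cons_cons]
      | 1, c :: t, h => simp at h; simp [prefixInd_cons_cons, h]
      | s + 2, t, _ => simp [prefixInd_cons_cons, List.replicate_succ]
    · rintro b c acc t rfl rfl
      simp [riseInd, swap]
    · simp
  · intro x acc t _ _
    exact scan_eq_zero_of_forall (by simp [prefixInd_cons_cons]) _ _ _
  · intro x acc t _
    exact scan_eq_zero_of_forall (by simp [prefixInd_cons_cons]) _ _ _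

theorem sum_132 [∀ x, Decidable (lo x)] (hd : RunData k s q p lo hi)
    (hk : 1 ≤ k) :
    scan (fun a t => riseInd (a.map swap) * prefixInd [U, U] t) [] (runsPath s q p 1 (k - 1)) [] =
      ∑ x ∈ Finset.Ico 1 (k + 1), if s x = 0 ∧ 0 < q x ∧ lo x then 1 else 0 := by
  rw [scan_runsPath hd hk _ (fun _ => 0) (fun x => if s x = 0 ∧ 0 < q x ∧ lo x then 1 else 0)
    (fun _ => 0)]
  · simp
  · simp [hd.q_last]
  · intro x acc t _ _
    exact scan_eq_zero_of_forall (by simp [prefixInd_cons_cons]) _ _ _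
  · intro x acc t hl hr
    rw [scan_of_boundary (fun c => c = U)]
    -- If `s x > 0`, the left part ends with `F` and is no rise when read backwards; if `s x = 0`,
    -- the second `U` on the right requires `q x > 0`.
    · cases s x with
      | zero =>
        rw [List.replicate_zero, List.nil_append, riseInd_left hl]
        cases q x <;> simp [prefixInd_cons_cons, List.replicate_succ, Nat.add_comm 1]
      | succ s => simp [riseInd, List.replicate_succ, swap]
    · rintro b c acc t rfl rfl
      simp [riseInd, swap]
    · simp
  · intro x acc t _
    exact scan_eq_zero_of_forall (by simp [prefixInd_cons_cons]) _ _ _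

theorem sum_213 [∀ x, Decidable (hi x)] (hd : RunData k s q p lo hi)
    (hk : 1 ≤ k) :
    scan (fun a t => prefixInd [U, U] (a.map swap) * riseInd t) [] (runsPath s q p 1 (k - 1)) [] =
      ∑ x ∈ Finset.Ico 1 (k + 1), if s x = 0 ∧ 0 < p x ∧ hi x then 1 else 0 := by
  rw [scan_runsPath hd hk _ (fun _ => 0) (fun x => if s x = 0 ∧ 0 < p x ∧ hi x then 1 else 0)
    (fun _ => 0)]
  · simp
  · simp [hd.hi_last]
  · intro x acc t _ _
    exact scan_eq_zero_of_forall (by simp [riseInd]) _ _ _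
  · intro x acc t hl hr
    rw [scan_of_boundary (fun c => c = U), riseInd_right hr]
    · cases s x with
      | zero =>
        rw [List.replicate_zero, List.nil_append, prefixInd_left hl]
        by_cases hi x <;> simp [*]
      | succ s => simp [prefixInd_cons_cons, List.replicate_succ, swap]
    · rintro b c acc t rfl rfl
      simp [prefixInd_cons_cons, swap]
    · simp
  · intro x acc t _
    exact scan_eq_zero_of_forall (by simp [riseInd]) _ _ _

theorem sum_123 [∀ x, Decidable (lo x)] [∀ x, Decidable (hi x)] (hd : RunData k s q p lo hi)
    (hk : 1 ≤ k) :
    scan (fun a t => riseInd (a.map swap) * (prefixInd [F] t * riseInd t.tail)) []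
        (runsPath s q p 1 (k - 1)) [] =
      ∑ x ∈ Finset.Ico 1 (k + 1), if s x = 1 ∧ lo x ∧ hi x then 1 else 0 := by
  rw [scan_runsPath hd hk _ (fun x => if s x = 1 ∧ lo x ∧ hi x then 1 else 0) (fun _ => 0)
    (fun _ => 0)]
  · simp
  · rfl
  · intro x acc t hl hr
    rw [scan_of_boundary (fun c => c = F), riseInd_left hl]
    · match s x with
      | 0 => simp
      | 1 => by_cases hi x <;> simp [prefixInd_cons_cons, riseInd_right hr, *]
      | s + 2 => simp [prefixInd_cons_cons, List.replicate_succ, riseInd]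
    · rintro b c acc t rfl rfl
      simp [riseInd, swap]
    · simp
  · intro x acc t _ _
    exact scan_eq_zero_of_forall (by simp [prefixInd_cons_cons]) _ _ _
  · intro x acc t _
    exact scan_eq_zero_of_forall (by simp [prefixInd_cons_cons]) _ _ _

theorem prefixInd_pair_of_head?_ne {c : Step} {a : List Step} (h : a.head? ≠ some c) :
    prefixInd [c.swap, c.swap] (a.map swap) = 0 ∧
      prefixInd [c.swap, c.swap] ((c :: a).map swap) = 0 := by
  cases a with
  | nil => simp [prefixInd_cons_cons]
  | cons d a =>
    have : c.swap ≠ d.swap := fun h' => h (by simp [Step.swap_injective h'])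
    simp [prefixInd_cons_cons, this]

theorem scan_cube (c : Step) (m : ℕ) {acc t : List Step} (hacc : acc.head? ≠ some c) :
    scan (fun a t => prefixInd [c.swap, c.swap] (a.map swap) * prefixInd [c] t) acc
      (List.replicate m c) t = m - 2 := by
  refine scan_replicate_of_cube c ?_ ?_ ?_ _ _ _ hacc
  · intro a t h; simp [(prefixInd_pair_of_head?_ne h).1]
  · intro a t h; rw [(prefixInd_pair_of_head?_ne h).2, zero_mul]
  · intro a t; simp [prefixInd_cons_cons]

theorem occ_cube (c : Step) (P : List Step) : occ [c, c, c] P =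
    scan (fun a t => prefixInd [c.swap, c.swap] (a.map swap) * prefixInd [c] t) [] P [] :=
  occ_append_eq_scan [c, c] (z := [c]) (by simp) P

theorem sum_111 (hd : RunData k s q p lo hi)
    (hk : 1 ≤ k) :
    occ [F, F, F] (runsPath s q p 1 (k - 1)) =
    ∑ x ∈ Finset.Ico 1 (k + 1), (s x - 2) := by
  rw [occ_cube, scan_runsPath hd hk _ (fun x => s x - 2) (fun _ => 0) (fun _ => 0)]
  · simp
  · rfl
  · intro x acc t hl hr
    refine scan_cube F _ ?_
    rcases hl.head with rfl | h <;> simp [*]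
  · intro x acc t _ _
    exact scan_eq_zero_of_forall (by simp [prefixInd_cons_cons]) _ _ _
  · intro x acc t _
    exact scan_eq_zero_of_forall (by simp [prefixInd_cons_cons]) _ _ _

theorem sum_UUU (hd : RunData k s q p lo hi)
    (hk : 1 ≤ k) :
    occ [U, U, U] (runsPath s q p 1 (k - 1)) =
    ∑ x ∈ Finset.Ico 1 (k + 1), (q x - 1) := by
  rw [occ_cube, scan_runsPath hd hk _ (fun _ => 0) (fun x => q x - 1) (fun _ => 0)]
  · simp
  · simp [hd.q_last]
  · intro x acc t _ _
    exact scan_eq_zero_of_forall (by simp [prefixInd_cons_cons]) _ _ _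
  · intro x acc t hl hr
    rw [scan_cube U]
    · omega
    · cases s x <;> rcases hl.head with rfl | h <;> simp [*, List.replicate_succ]
  · intro x acc t _
    exact scan_eq_zero_of_forall (by simp [prefixInd_cons_cons]) _ _ _

theorem sum_DDD (hd : RunData k s q p lo hi)
    (hk : 1 ≤ k) :
    occ [D, D, D] (runsPath s q p 1 (k - 1)) =
    ∑ x ∈ Finset.Ico 1 (k + 1), (p x - 1) := by
  rw [occ_cube, scan_runsPath hd hk _ (fun _ => 0) (fun _ => 0) (fun x => p x - 1)]
  -- The summand at `1` is missing on the path side, but it is zero because `p 1 = 0`.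
  · rw [Finset.sum_eq_sum_Ico_succ_bot (a := 1) (by omega) fun x => p x - 1]
    simp [hd.p_one]
  · rfl
  · intro x acc t _ _
    exact scan_eq_zero_of_forall (by simp [prefixInd_cons_cons]) _ _ _
  · intro x acc t _ _
    exact scan_eq_zero_of_forall (by simp [prefixInd_cons_cons]) _ _ _
  · intro x acc t _
    rw [scan_cube D]
    · omega
    · simp

theorem sum_FUU (hd : RunData k s q p lo hi)
    (hk : 1 ≤ k) :
    occ [F, U, U] (runsPath s q p 1 (k - 1)) =
    ∑ x ∈ Finset.Ico 1 (k + 1), if 0 < s x ∧ 0 < q x then 1 else 0 := by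
  rw [show [F, U, U] = [F] ++ [U, U] from rfl, occ_append_eq_scan _ (by simp),
    scan_runsPath hd hk _ (fun _ => 0) (fun x => if 0 < s x ∧ 0 < q x then 1 else 0) (fun _ => 0)]
  · simp
  · simp [hd.q_last]
  · intro x acc t _ _
    exact scan_eq_zero_of_forall (by simp [prefixInd_cons_cons]) _ _ _
  · intro x acc t hl hr
    rw [scan_of_boundary (fun c => c = U)]
    · match s x, q x, acc, hl.head with
      | 0, _, [], _ => simp
      | 0, _, c :: acc, h => simp at h; simp [prefixInd_cons_cons, h, swap]
      | s + 1, 0, _, _ => simp [prefixInd_cons_cons]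
      | s + 1, q + 1, _, _ =>
        simp [prefixInd_cons_cons, swap, List.replicate_succ, Nat.add_comm 1]
    · rintro b c acc t rfl rfl
      simp [prefixInd_cons_cons, swap]
    · simp
  · intro x acc t _
    exact scan_eq_zero_of_forall (by simp [prefixInd_cons_cons]) _ _ _

theorem sum_DDF (hd : RunData k s q p lo hi)
    (hk : 1 ≤ k) :
    occ [D, D, F] (runsPath s q p 1 (k - 1)) =
    ∑ x ∈ Finset.Ico 1 (k + 1), if 0 < s x ∧ 0 < p x then 1 else 0 := by
  rw [show [D, D, F] = [D, D] ++ [F] from rfl, occ_append_eq_scan _ (by simp),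
    scan_runsPath hd hk _ (fun x => if 0 < s x ∧ 0 < p x then 1 else 0) (fun _ => 0) (fun _ => 0)]
  · simp
  · rfl
  · intro x acc t hl hr
    rw [scan_of_boundary (fun c => c = F)]
    · have h := prefixInd_left hl
      simp only [List.reverse_cons, List.reverse_nil, List.nil_append, List.map_cons,
        List.map_nil, List.cons_append, swap, h]
      cases s x <;> simp [prefixInd_cons_cons, List.replicate_succ]
    · rintro b c acc t rfl rfl
      simp [prefixInd_cons_cons, swap]
    · simp
  · intro x acc t _ _
    exact scan_eq_zero_of_forall (by simp [prefixInd_cons_cons]) _ _ _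
  · intro x acc t _
    exact scan_eq_zero_of_forall (by simp [prefixInd_cons_cons]) _ _ _

end Formulas

/-! ### The path of a sequence of blocks -/

/-- The path of a `k`-ary sequence of blocks. -/
def blocksPath (k : ℕ) (L : List (ℕ × ℕ)) : List Step :=
  runsPath (fun x => L.count (x, x)) (minPairs L) (maxPairs L) 1 (k - 1)

theorem faroPath_blocksWord (k : ℕ) {L : List (ℕ × ℕ)} (h : IsBlocks L) :
    faroPath k (blocksWord L) = blocksPath k L := by
  rw [faroPath_eq_runsPath, blocksPath]
  congr 1 <;> ext x
  · exact (counts_blocksWord h x).1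
  · exact (counts_blocksWord h x).2.1
  · exact (counts_blocksWord h x).2.2

theorem minPairs_pos {L : List (ℕ × ℕ)} {x : ℕ} :
    0 < minPairs L x ↔ ∃ B ∈ L, B.1 < B.2 ∧ B.1 = x := by
  simp [minPairs, List.countP_pos_iff]

theorem maxPairs_pos {L : List (ℕ × ℕ)} {x : ℕ} :
    0 < maxPairs L x ↔ ∃ B ∈ L, B.1 < B.2 ∧ B.2 = x := by
  simp [maxPairs, List.countP_pos_iff]

theorem runData_of_isBlocks {k : ℕ} {L : List (ℕ × ℕ)} (h : IsBlocks L)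
    (hk : ∀ B ∈ L, 1 ≤ B.1 ∧ B.2 ≤ k) :
    RunData k (fun x => L.count (x, x)) (minPairs L) (maxPairs L) (HasBelow L) (HasAbove L) where
  p_one := by
    by_contra h0
    obtain ⟨B, hB, h1, h2⟩ := maxPairs_pos.1 (Nat.pos_of_ne_zero h0)
    have := hk B hB
    omega
  q_last := by
    by_contra h0
    obtain ⟨B, hB, h1, h2⟩ := minPairs_pos.1 (Nat.pos_of_ne_zero h0)
    have := hk B hB
    omega
  lo_one := by
    rintro ⟨B, hB, h1⟩
    have := hk B hB
    omega
  hi_last := by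
    rintro ⟨B, hB, h1⟩
    have := hk B hB
    omega
  lo_succ x := by
    rw [minPairs_pos, maxPairs_pos, List.count_pos_iff]
    constructor
    · rintro ⟨B, hB, h1⟩
      have h2 := h.1 B hB
      rcases Nat.lt_succ_iff_lt_or_eq.1 h1 with h1 | h1
      · exact Or.inr (Or.inr (Or.inr ⟨B, hB, h1⟩))
      rcases h2.lt_or_eq with h2 | h2
      · exact Or.inl ⟨B, hB, h2, h1⟩
      · have : B = (x, x) := Prod.ext h1 (h2 ▸ h1)
        exact Or.inr (Or.inr (Or.inl (this ▸ hB)))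
    · rintro (⟨B, hB, h1, h2⟩ | ⟨B, hB, h1, h2⟩ | hB | ⟨B, hB, h1⟩)
      · exact ⟨B, hB, by omega⟩
      · exact ⟨B, hB, by omega⟩
      · exact ⟨_, hB, by simp⟩
      · exact ⟨B, hB, by omega⟩
  hi_eq x := by
    rw [minPairs_pos, maxPairs_pos, List.count_pos_iff]
    constructor
    · rintro ⟨B, hB, h1⟩
      have h2 := h.1 B hB
      rcases Nat.lt_or_eq_of_le (Nat.succ_le_of_lt h1) with h1 | h1
      · exact Or.inr (Or.inr (Or.inr ⟨B, hB, h1⟩))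
      rcases h2.lt_or_eq with h2 | h2
      · exact Or.inr (Or.inl ⟨B, hB, h2, h1.symm⟩)
      · have : B = (x + 1, x + 1) := Prod.ext (by omega) (by omega)
        exact Or.inr (Or.inr (Or.inl (this ▸ hB)))
    · rintro (⟨B, hB, h1, h2⟩ | ⟨B, hB, h1, h2⟩ | hB | ⟨B, hB, h1⟩)
      · exact ⟨B, hB, by omega⟩
      · exact ⟨B, hB, by omega⟩
      · exact ⟨_, hB, by simp⟩
      · exact ⟨B, hB, by omega⟩

/-! ### Validity, peaks and length of the path -/

theorem validFrom_replicate_U (h m : ℕ) (t : List Step) :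
    ValidFrom h (List.replicate m U ++ t) ↔ ValidFrom (h + m) t := by
  induction m generalizing h with
  | zero => simp
  | succ m ih =>
    rw [List.replicate_succ, List.cons_append, ValidFrom, ih, Nat.add_assoc, Nat.add_comm 1 m]

theorem validFrom_replicate_D (h m : ℕ) (t : List Step) :
    ValidFrom h (List.replicate m D ++ t) ↔ m ≤ h ∧ ValidFrom (h - m) t := by
  induction m generalizing h with
  | zero => simp
  | succ m ih =>
    rw [List.replicate_succ, List.cons_append, ValidFrom, ih, Nat.sub_sub, Nat.add_comm 1 m]
    constructor
    · rintro ⟨h1, h2, h3⟩; exact ⟨by omega, h3⟩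
    · rintro ⟨h1, h3⟩; exact ⟨by omega, by omega, h3⟩

theorem validFrom_replicate_F (h m : ℕ) (t : List Step) :
    ValidFrom h (List.replicate m F ++ t) ↔ (0 < m → h = 0) ∧ ValidFrom h t := by
  induction m generalizing h with
  | zero => simp
  | succ m ih =>
    rw [List.replicate_succ, List.cons_append, ValidFrom, ih]
    constructor
    · rintro ⟨rfl, -, h⟩; exact ⟨fun _ => rfl, h⟩
    · rintro ⟨h1, h⟩
      obtain rfl := h1 (by omega)
      exact ⟨rfl, fun _ => rfl, h⟩

theorem validFrom_runsPath {s q p H : ℕ → ℕ} {k : ℕ} (h1 : ∀ x, 0 < s x → H x = 0)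
    (h2 : ∀ x, H x + q x = H (x + 1) + p (x + 1)) (h3 : H k = 0) (m x : ℕ) (hx : x + m = k) :
    ValidFrom (H x) (runsPath s q p x m) := by
  induction m generalizing x with
  | zero =>
    obtain rfl : x = k := by omega
    rw [runsPath, ← List.append_nil (List.replicate _ _), validFrom_replicate_F]
    exact ⟨h1 x, h3⟩
  | succ m ih =>
    have := h2 x
    rw [runsPath, validFrom_replicate_F, validFrom_replicate_U, validFrom_replicate_D]
    refine ⟨h1 x, by omega, ?_⟩
    rw [show H x + (1 + q x) - (1 + p (x + 1)) = H (x + 1) by omega]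
    exact ih (x + 1) (by omega)

theorem validFrom_blocksPath {k : ℕ} (hk1 : 1 ≤ k) {L : List (ℕ × ℕ)} (h : IsBlocks L)
    (hk : ∀ B ∈ L, 1 ≤ B.1 ∧ B.2 ≤ k) : ValidFrom 0 (blocksPath k L) := by
  -- The height at `F^{s(x)}` is the number of pairs opened but not yet closed there, that is, of
  -- pairs with `x` strictly between their letters.
  have key := validFrom_runsPath (s := fun x => L.count (x, x)) (q := minPairs L)
    (p := maxPairs L) (H := fun x => L.countP fun B => B.1 < x ∧ x < B.2) (k := k) ?_ ?_ ?_
    (k - 1) 1 (by omega)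
  · have h0 : (L.countP fun B => B.1 < 1 ∧ 1 < B.2) = 0 := by
      rw [List.countP_eq_zero]
      intro B hB
      have := hk B hB
      simp; omega
    simp only [h0] at key
    exact key
  · intro x hx
    rw [List.count_pos_iff] at hx
    simp only [List.countP_eq_zero]
    intro B hB hBx
    simp only [decide_eq_true_eq] at hBx
    have hne : B ≠ (x, x) := by rintro rfl; simp at hBx
    -- Blocks of the sequence are comparable, but a pair with `x` strictly between its letters is
    -- not comparable with `(x, x)`.
    have hpw : L.Pairwise fun B C => B ≤ C ∨ C ≤ B := h.2.imp Or.inl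
    have : Std.Symm fun B C : ℕ × ℕ => B ≤ C ∨ C ≤ B := ⟨fun _ _ => Or.symm⟩
    rcases hpw.forall hB hx hne with h | h
    · have := h.2; simp only at this; omega
    · have := h.1; simp only at this; omega
  -- Both sides count the blocks with smaller letter at most `x` and larger letter at least `x + 1`.
  · intro x
    clear hk h
    induction L with
    | nil => simp [minPairs, maxPairs]
    | cons B L ih =>
      simp only [minPairs, maxPairs, List.countP_cons, decide_eq_true_eq] at ih ⊢
      split_ifs <;> omega
  · rw [List.countP_eq_zero]
    intro B hB
    have := hk B hB
    simp; omega

theorem occ_UD_replicate {c : Step} (hc : c ≠ U) (m : ℕ) (t : List Step) :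
    occ [U, D] (List.replicate m c ++ t) = occ [U, D] t := by
  induction m with
  | zero => simp
  | succ m ih =>
    rw [List.replicate_succ, List.cons_append, occ_cons, ih, prefixInd_cons_cons,
      if_neg (Ne.symm hc), zero_add]

theorem occ_UD_runs (a b : ℕ) (t : List Step) :
    occ [U, D] (List.replicate (1 + a) U ++ (List.replicate (1 + b) D ++ t)) =
      1 + occ [U, D] t := by
  induction a with
  | zero =>
    rw [List.replicate_one, List.singleton_append, occ_cons, occ_UD_replicate (by simp)]
    simp [prefixInd_cons_cons, List.replicate_succ, Nat.add_comm 1]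
  | succ a ih =>
    rw [← Nat.add_assoc, List.replicate_succ, List.cons_append, occ_cons, ih]
    simp [prefixInd_cons_cons, List.replicate_succ, Nat.add_comm 1]

/-- The summand `1` in the exponents makes all runs of `U` and `D` nonempty, so each of the `m`
factors contributes exactly one peak. -/
theorem occ_UD_runsPath (s q p : ℕ → ℕ) (x m : ℕ) : occ [U, D] (runsPath s q p x m) = m := by
  induction m generalizing x with
  | zero =>
    rw [runsPath, ← List.append_nil (List.replicate _ _), occ_UD_replicate (by simp)]
    rfl
  | succ m ih => rw [runsPath, occ_UD_replicate (by simp), occ_UD_runs, ih, add_comm]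

theorem length_runsPath (s q p : ℕ → ℕ) (x m : ℕ) :
    (runsPath s q p x m).length = ∑ y ∈ Finset.Ico x (x + m + 1), s y +
      ∑ y ∈ Finset.Ico x (x + m), q y + ∑ y ∈ Finset.Ico (x + 1) (x + m + 1), p y + 2 * m := by
  induction m generalizing x with
  | zero => simp [runsPath]
  | succ m ih =>
    rw [Finset.sum_eq_sum_Ico_succ_bot (by omega) s, Finset.sum_eq_sum_Ico_succ_bot (by omega) q,
      Finset.sum_eq_sum_Ico_succ_bot (a := x + 1) (by omega) p, runsPath]
    simp only [List.length_append, List.length_replicate, ih]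
    rw [show x + 1 + m = x + (m + 1) by omega]
    omega

/-- A pair is counted once by its smaller and once by its larger letter, which accounts for its two
letters; a singleton is counted once. -/
theorem sum_counts {k : ℕ} {L : List (ℕ × ℕ)} (h : IsBlocks L)
    (hk : ∀ B ∈ L, 1 ≤ B.1 ∧ B.2 ≤ k) :
    ∑ x ∈ Finset.Ico 1 (k + 1), L.count (x, x) + ∑ x ∈ Finset.Ico 1 (k + 1), minPairs L x +
      ∑ x ∈ Finset.Ico 1 (k + 1), maxPairs L x = (blocksWord L).length := by
  induction L with
  | nil => simp [minPairs, maxPairs]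
  | cons B L ih =>
    have ih := ih (isBlocks_cons.1 h).2.2 fun C hC => hk C (by simp [hC])
    obtain ⟨a, b⟩ := B
    have hB := hk (a, b) (by simp)
    simp only [minPairs, maxPairs] at ih ⊢
    simp only [List.count_cons, List.countP_cons, Finset.sum_add_distrib, blocksWord_cons,
      List.length_append, ← ih]
    rcases (isBlocks_cons.1 h).1.eq_or_lt with hab | hab
    · simp only at hab hB
      subst hab
      simp only [blockWord]
      simp [hB]
      omega
    · simp only at hab hB
      have hne : ∀ x, ¬ (a = x ∧ b = x) := by omega
      simp [blockWord, hab, hne, hB, show a ≤ k by omega, show 1 ≤ b by omega]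
      omega

theorem length_blocksPath {k : ℕ} (hk1 : 1 ≤ k) {L : List (ℕ × ℕ)} (h : IsBlocks L)
    (hk : ∀ B ∈ L, 1 ≤ B.1 ∧ B.2 ≤ k) :
    (blocksPath k L).length = (blocksWord L).length + 2 * (k - 1) := by
  have hd := runData_of_isBlocks h hk
  rw [blocksPath, length_runsPath, ← sum_counts h hk, Nat.add_sub_cancel' hk1,
    Finset.sum_Ico_succ_top hk1 (minPairs L), hd.q_last,
    Finset.sum_eq_sum_Ico_succ_bot (a := 1) (by omega) (maxPairs L), hd.p_one]
  omega

theorem blocksPath_mem {k : ℕ} (hk1 : 1 ≤ k) {L : List (ℕ × ℕ)} (h : IsBlocks L)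
    (hk : ∀ B ∈ L, 1 ≤ B.1 ∧ B.2 ≤ k) :
    blocksPath k L ∈ dispersedDyck ((blocksWord L).length + 2 * (k - 1)) (k - 1) :=
  ⟨length_blocksPath hk1 h hk, (isDispersedDyck_iff _).2 (validFrom_blocksPath hk1 h hk),
    occ_UD_runsPath _ _ _ _ _⟩

/-! ### Injectivity -/

theorem replicate_append_inj {α : Type*} {c : α} {m n : ℕ} {t u : List α}
    (ht : t.head? ≠ some c) (hu : u.head? ≠ some c)
    (h : List.replicate m c ++ t = List.replicate n c ++ u) : m = n ∧ t = u := by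
  induction m generalizing n with
  | zero =>
    cases n with
    | zero => exact ⟨rfl, by simpa using h⟩
    | succ n => simp [List.replicate_succ] at h; simp [h] at ht
  | succ m ih =>
    cases n with
    | zero => simp [List.replicate_succ] at h; simp [← h] at hu
    | succ n =>
      simp only [List.replicate_succ, List.cons_append, List.cons.injEq, true_and] at h
      obtain ⟨h1, h2⟩ := ih h
      exact ⟨by omega, h2⟩

/-- Each run is maximal: `F`-runs are followed by `U` or by the end, `U`-runs by `D`, and `D`-runs
never by `D`. The run lengths can therefore be read off the path. -/
theorem runsPath_inj {s q p s' q' p' : ℕ → ℕ} {m x : ℕ}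
    (h : runsPath s q p x m = runsPath s' q' p' x m) :
    (∀ y, x ≤ y → y ≤ x + m → s y = s' y) ∧ (∀ y, x ≤ y → y < x + m → q y = q' y) ∧
      ∀ y, x < y → y ≤ x + m → p y = p' y := by
  induction m generalizing x with
  | zero =>
    simp only [runsPath, List.replicate_inj, Nat.add_zero] at h ⊢
    refine ⟨fun y h1 h2 => ?_, fun y h1 h2 => by omega, fun y h1 h2 => by omega⟩
    obtain rfl : y = x := by omega
    exact h.1
  | succ m ih =>
    rw [runsPath, runsPath] at h
    obtain ⟨h1, h⟩ := replicate_append_inj (by simp [List.replicate_succ, Nat.add_comm 1])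
      (by simp [List.replicate_succ, Nat.add_comm 1]) h
    obtain ⟨h2, h⟩ := replicate_append_inj (by simp [List.replicate_succ, Nat.add_comm 1])
      (by simp [List.replicate_succ, Nat.add_comm 1]) h
    obtain ⟨h3, h⟩ := replicate_append_inj (head?_runsPath_ne_D _ _ _ _ _)
      (head?_runsPath_ne_D _ _ _ _ _) h
    obtain ⟨i1, i2, i3⟩ := ih h
    refine ⟨fun y h4 h5 => ?_, fun y h4 h5 => ?_, fun y h4 h5 => ?_⟩
    · rcases h4.eq_or_lt with rfl | h4
      exacts [h1, i1 y (by omega) (by omega)]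
    · rcases h4.eq_or_lt with rfl | h4
      exacts [by omega, i2 y (by omega) (by omega)]
    · rcases (Nat.succ_le_of_lt h4).eq_or_lt with rfl | h4
      exacts [by simpa using h3, i3 y (by omega) (by omega)]

theorem count_map_fst {L : List (ℕ × ℕ)} (h : IsBlocks L) (x : ℕ) :
    (L.map Prod.fst).count x = L.count (x, x) + minPairs L x := by
  induction L with
  | nil => simp [minPairs]
  | cons B L ih =>
    have ih := ih (isBlocks_cons.1 h).2.2
    have hB := (isBlocks_cons.1 h).1
    obtain ⟨a, b⟩ := B
    simp only at hB
    simp only [minPairs, List.map_cons, List.count_cons, List.countP_cons, ih, beq_iff_eq,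
      Prod.mk.injEq, decide_eq_true_eq]
    split_ifs <;> omega

theorem count_map_snd {L : List (ℕ × ℕ)} (h : IsBlocks L) (x : ℕ) :
    (L.map Prod.snd).count x = L.count (x, x) + maxPairs L x := by
  induction L with
  | nil => simp [maxPairs]
  | cons B L ih =>
    have ih := ih (isBlocks_cons.1 h).2.2
    have hB := (isBlocks_cons.1 h).1
    obtain ⟨a, b⟩ := B
    simp only at hB
    simp only [maxPairs, List.map_cons, List.count_cons, List.countP_cons, ih, beq_iff_eq,
      Prod.mk.injEq, decide_eq_true_eq]
    split_ifs <;> omega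

/-- The counts determine the multiset of each coordinate, and both coordinates are sorted along the
sequence. The two sorted lists, zipped, give the blocks back. -/
theorem isBlocks_ext {L L' : List (ℕ × ℕ)} (h : IsBlocks L) (h' : IsBlocks L')
    (hs : ∀ x, L.count (x, x) = L'.count (x, x)) (hq : ∀ x, minPairs L x = minPairs L' x)
    (hp : ∀ x, maxPairs L x = maxPairs L' x) : L = L' := by
  have h1 : L.map Prod.fst = L'.map Prod.fst := by
    refine List.Perm.eq_of_pairwise (le := (· ≤ ·)) (fun a b _ _ => le_antisymm) ?_ ?_
      (List.perm_iff_count.2 fun x => ?_)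
    · exact List.pairwise_map.2 (h.2.imp fun h => h.1)
    · exact List.pairwise_map.2 (h'.2.imp fun h => h.1)
    · rw [count_map_fst h, count_map_fst h', hs, hq]
  have h2 : L.map Prod.snd = L'.map Prod.snd := by
    refine List.Perm.eq_of_pairwise (le := (· ≤ ·)) (fun a b _ _ => le_antisymm) ?_ ?_
      (List.perm_iff_count.2 fun x => ?_)
    · exact List.pairwise_map.2 (h.2.imp fun h => h.2)
    · exact List.pairwise_map.2 (h'.2.imp fun h => h.2)
    · rw [count_map_snd h, count_map_snd h', hs, hp]
  have e : ∀ L : List (ℕ × ℕ), L = (L.map Prod.fst).zip (L.map Prod.snd) := by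
    intro L
    induction L with
    | nil => rfl
    | cons B L ih => simp [← ih]
  rw [e L, e L', h1, h2]

theorem blocksPath_inj {k : ℕ} (hk1 : 1 ≤ k) {L L' : List (ℕ × ℕ)} (h : IsBlocks L)
    (hk : ∀ B ∈ L, 1 ≤ B.1 ∧ B.2 ≤ k) (h' : IsBlocks L') (hk' : ∀ B ∈ L', 1 ≤ B.1 ∧ B.2 ≤ k)
    (he : blocksPath k L = blocksPath k L') : L = L' := by
  obtain ⟨i1, i2, i3⟩ := runsPath_inj he
  -- The path records the counts only for letters in its range; elsewhere they vanish for any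
  -- `k`-ary sequence.
  have out : ∀ {L : List (ℕ × ℕ)}, (∀ B ∈ L, 1 ≤ B.1 ∧ B.2 ≤ k) → ∀ x,
      ((x < 1 ∨ k < x) → L.count (x, x) = 0) ∧ ((x < 1 ∨ k ≤ x) → minPairs L x = 0) ∧
        ((x ≤ 1 ∨ k < x) → maxPairs L x = 0) := by
    intro L hk x
    refine ⟨fun hx => ?_, fun hx => ?_, fun hx => ?_⟩
    · rw [List.count_eq_zero]
      intro hB
      have := hk _ hB
      simp only at this
      omega
    · by_contra h0
      obtain ⟨B, hB, h1, h2⟩ := minPairs_pos.1 (Nat.pos_of_ne_zero h0)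
      have := hk B hB
      omega
    · by_contra h0
      obtain ⟨B, hB, h1, h2⟩ := maxPairs_pos.1 (Nat.pos_of_ne_zero h0)
      have := hk B hB
      omega
  refine isBlocks_ext h h' (fun x => ?_) (fun x => ?_) (fun x => ?_)
  · by_cases hx : x < 1 ∨ k < x
    · rw [(out hk x).1 hx, (out hk' x).1 hx]
    · exact i1 x (by omega) (by omega)
  · by_cases hx : x < 1 ∨ k ≤ x
    · rw [(out hk x).2.1 hx, (out hk' x).2.1 hx]
    · exact i2 x (by omega) (by omega)
  · by_cases hx : x ≤ 1 ∨ k < x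
    · rw [(out hk x).2.2 hx, (out hk' x).2.2 hx]
    · exact i3 x (by omega) (by omega)

/-! ### Surjectivity -/

theorem exists_replicate_append (c : Step) (P : List Step) :
    ∃ m t, P = List.replicate m c ++ t ∧ t.head? ≠ some c := by
  induction P with
  | nil => exact ⟨0, [], by simp⟩
  | cons d P ih =>
    by_cases hd : d = c
    · subst hd
      obtain ⟨m, t, rfl, ht⟩ := ih
      exact ⟨m + 1, t, by simp [List.replicate_succ], ht⟩
    · exact ⟨0, d :: P, by simp, by simpa using hd⟩

/-- After the level steps, a valid path that does not go down either stops or climbs; a climb must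
end with `D`, since level steps and the end of the path are possible only at height zero. -/
theorem exists_runs {h : ℕ} {P : List Step} (hP : ValidFrom h P) (hD : P.head? ≠ some D) :
    ∃ s, (0 < s → h = 0) ∧ ((h = 0 ∧ P = List.replicate s F) ∨ ∃ q p P', p ≤ h + q ∧
      P = List.replicate s F ++ (List.replicate (1 + q) U ++ (List.replicate (1 + p) D ++ P')) ∧
      P'.head? ≠ some D ∧ ValidFrom (h + q - p) P') := by
  obtain ⟨s, P1, rfl, h1⟩ := exists_replicate_append F P
  rw [validFrom_replicate_F] at hP
  refine ⟨s, hP.1, ?_⟩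
  have hD1 : P1.head? ≠ some D := by
    cases s with
    | zero => simpa using hD
    | succ s =>
      intro h0
      have hh := hP.1 (by omega)
      have hP := hP.2
      cases P1 with
      | nil => simp at h0
      | cons c P1 =>
        obtain rfl : c = D := by simpa using h0
        have := hP.1
        omega
  obtain ⟨q, P2, rfl, h2⟩ := exists_replicate_append U P1
  rw [validFrom_replicate_U] at hP
  cases q with
  | zero =>
    left
    match P2, h1, h2, hD1, hP with
    | [], _, _, _, hP => exact ⟨hP.2, by simp⟩
    | F :: P2, h1, _, _, _ => simp at h1
    | D :: P2, _, _, hD1, _ => simp at hD1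
    | U :: P2, _, h2, _, _ => simp at h2
  | succ q =>
    right
    obtain ⟨p, P3, rfl, h3⟩ := exists_replicate_append D P2
    rw [validFrom_replicate_D] at hP
    cases p with
    | zero =>
      exfalso
      have hP := hP.2.2
      match P3, h2, h3, hP with
      | [], _, _, hP => simp [ValidFrom] at hP
      | F :: P3, _, _, hP => simp [ValidFrom] at hP
      | D :: P3, _, h3, _ => simp at h3
      | U :: P3, h2, _, _ => simp at h2
    | succ p =>
      refine ⟨q, p, P3, by omega, by rw [Nat.add_comm 1, Nat.add_comm 1], h3, ?_⟩
      rw [show h + q - p = h + (q + 1) - (p + 1) by omega]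
      exact hP.2.2

theorem runsPath_congr {s q p s' q' p' : ℕ → ℕ} {m x : ℕ} (hs : ∀ y, x ≤ y → s y = s' y)
    (hq : ∀ y, x ≤ y → q y = q' y) (hp : ∀ y, x < y → p y = p' y) :
    runsPath s q p x m = runsPath s' q' p' x m := by
  induction m generalizing x with
  | zero => rw [runsPath, runsPath, hs x le_rfl]
  | succ m ih =>
    rw [runsPath, runsPath, hs x le_rfl, hq x le_rfl, hp (x + 1) (by omega),
      ih (fun y hy => hs y (by omega)) (fun y hy => hq y (by omega))
        (fun y hy => hp y (by omega))]

theorem isBlocks_of_pairwise {L : List (ℕ × ℕ)} (h : ∀ B ∈ L, B.1 ≤ B.2)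
    (h1 : (L.map Prod.fst).Pairwise (· ≤ ·)) (h2 : (L.map Prod.snd).Pairwise (· ≤ ·)) :
    IsBlocks L :=
  ⟨h, ((List.pairwise_map.1 h1).and (List.pairwise_map.1 h2)).imp fun h => ⟨h.1, h.2⟩⟩

theorem pairwise_replicate_le (m x : ℕ) : (List.replicate m x).Pairwise (· ≤ ·) := by
  simp [List.pairwise_replicate]

/-- The blocks of a path are found from left to right. The list `pend` contains the smaller letters
of the pairs that have been opened but not closed so far. -/
theorem exists_blocks (m : ℕ) : ∀ (x h : ℕ) (pend : List ℕ) (P : List Step), ValidFrom h P →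
    P.head? ≠ some D → occ [U, D] P = m → pend.length = h → pend.Pairwise (· ≤ ·) →
    (∀ a ∈ pend, a < x) → ∃ L, IsBlocks L ∧ (∀ B ∈ L, x ≤ B.2 ∧ B.2 ≤ x + m) ∧
      (∀ B ∈ L, B.2 = x → B.1 = x) ∧ (∃ rest, L.map Prod.fst = pend ++ rest ∧ ∀ r ∈ rest, x ≤ r) ∧
      runsPath (fun x => L.count (x, x)) (minPairs L) (maxPairs L) x m = P := by
  induction m with
  | zero =>
    intro x h pend P hP hD hm hl hpw hx
    obtain ⟨s, -, ⟨rfl, rfl⟩ | ⟨q, p, P', -, rfl, -⟩⟩ := exists_runs hP hD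
    · obtain rfl := List.eq_nil_of_length_eq_zero hl
      refine ⟨List.replicate s (x, x), isBlocks_of_pairwise ?_ ?_ ?_, ?_, ?_,
        ⟨List.replicate s x, ?_, ?_⟩, ?_⟩
      · intro B hB; rw [List.eq_of_mem_replicate hB]
      · simp
      · simp
      · intro B hB; rw [List.eq_of_mem_replicate hB]; simp
      · intro B hB; rw [List.eq_of_mem_replicate hB]; simp
      · simp
      · intro r hr; rw [List.eq_of_mem_replicate hr]
      · simp [runsPath]
    · rw [occ_UD_replicate (by simp), occ_UD_runs] at hm
      omega
  | succ m ih =>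
    intro x h pend P hP hD hm hl hpw hx
    obtain ⟨s, hs, ⟨rfl, rfl⟩ | ⟨q, p, P', hpq, rfl, hD', hP'⟩⟩ := exists_runs hP hD
    · rw [← List.append_nil (List.replicate _ _), occ_UD_replicate (by simp)] at hm
      simp [occ] at hm
    rw [occ_UD_replicate (by simp), occ_UD_runs] at hm
    -- `Q` is the queue of open smaller letters after the run of `U`. The obligatory extra `U` and
    -- `D` of the peak cancel and open no pair.
    set Q := pend ++ List.replicate q x with hQ
    have hQl : Q.length = h + q := by simp [hQ, hl]
    have hQx : ∀ a ∈ Q, a ≤ x := by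
      intro a ha
      rcases List.mem_append.1 ha with ha | ha
      · exact (hx a ha).le
      · rw [List.eq_of_mem_replicate ha]
    have hQpw : Q.Pairwise (· ≤ ·) := by
      rw [hQ, List.pairwise_append]
      refine ⟨hpw, pairwise_replicate_le _ _, fun a ha b hb => ?_⟩
      rw [List.eq_of_mem_replicate hb]
      exact (hx a ha).le
    obtain ⟨L', hL', hb, hx', ⟨rest, hrest, hr⟩, rfl⟩ := ih (x + 1) (h + q - p) (Q.drop p) P' hP'
      hD' (by omega) (by simp [hQl]) (hQpw.sublist (List.drop_sublist _ _))
      (fun a ha => Nat.lt_succ_of_le (hQx a (List.mem_of_mem_drop ha)))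
    -- The `p` pairs closed at `x + 1` take the oldest open letters, as required for both
    -- coordinates to stay sorted.
    set M := (Q.take p).map fun a => (a, x + 1) with hM
    have hMmem : ∀ B ∈ M, B.1 ≤ x ∧ B.2 = x + 1 := by
      intro B hB
      obtain ⟨a, ha, rfl⟩ := List.mem_map.1 hB
      exact ⟨hQx a (List.mem_of_mem_take ha), rfl⟩
    have hMl : M.length = p := by simp [hM, hQl, hpq]
    have hfst : (List.replicate s (x, x) ++ M ++ L').map Prod.fst =
        pend ++ (List.replicate s x ++ (List.replicate q x ++ rest)) := by
      have e1 : M.map Prod.fst = Q.take p := by simp [hM, Function.comp_def]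
      rw [List.map_append, List.map_append, hrest, e1, List.append_assoc,
        ← List.append_assoc (List.take p Q), List.take_append_drop]
      -- The singletons `x` stand before the pending letters on one side and after them on the
      -- other. This is harmless: if there are singletons, the height is zero and nothing is
      -- pending.
      rcases Nat.eq_zero_or_pos s with rfl | hs0
      · simp [hQ]
      · have : pend = [] := List.eq_nil_of_length_eq_zero (by rw [hl, hs hs0])
        simp [hQ, this]
    have hcountL' : ∀ y ≤ x, L'.count (y, y) = 0 ∧ maxPairs L' y = 0 := by
      intro y hy
      refine ⟨List.count_eq_zero.2 fun hB => ?_, ?_⟩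
      · have := (hb _ hB).1; simp only at this; omega
      · by_contra h0
        obtain ⟨B, hB, h1, h2⟩ := maxPairs_pos.1 (Nat.pos_of_ne_zero h0)
        have := hb B hB
        omega
    -- The pairs closed at `x + 1` are all in `M`; the clause that blocks of `L'` with larger letter
    -- `x + 1` are singletons is carried through the induction for this purpose.
    have hmaxL' : maxPairs L' (x + 1) = 0 := by
      by_contra h0
      obtain ⟨B, hB, h1, h2⟩ := maxPairs_pos.1 (Nat.pos_of_ne_zero h0)
      have := hx' B hB h2
      omega
    have hcount : ∀ y, (List.replicate s (x, x) ++ M ++ L').count (y, y) =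
        (if y = x then s else 0) + L'.count (y, y) := by
      intro y
      have : M.count (y, y) = 0 := by
        rw [List.count_eq_zero]
        intro hB
        have := hMmem _ hB
        simp only at this
        omega
      rw [List.count_append, List.count_append, this, List.count_replicate]
      by_cases hy : y = x
      · simp [hy]
      · simp [hy, Ne.symm hy]
    have hmax : ∀ y, maxPairs (List.replicate s (x, x) ++ M ++ L') y =
        (if y = x + 1 then p else 0) + maxPairs L' y := by
      intro y
      have h1 : maxPairs (List.replicate s (x, x)) y = 0 := by
        rw [maxPairs, List.countP_eq_zero]
        intro B hB
        rw [List.eq_of_mem_replicate hB]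
        simp
      have h2 : maxPairs M y = if y = x + 1 then p else 0 := by
        split_ifs with hy
        · rw [maxPairs, ← hMl, List.countP_eq_length]
          intro B hB
          have := hMmem B hB
          simp; omega
        · rw [maxPairs, List.countP_eq_zero]
          intro B hB
          have := hMmem B hB
          simp; omega
      simp only [maxPairs] at h1 h2 ⊢
      rw [List.countP_append, List.countP_append, h1, h2, zero_add]
    have hL : IsBlocks (List.replicate s (x, x) ++ M ++ L') := by
      refine isBlocks_of_pairwise ?_ ?_ ?_
      · intro B hB
        simp only [List.mem_append] at hB
        rcases hB with (hB | hB) | hB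
        · rw [List.eq_of_mem_replicate hB]
        · have := hMmem B hB; omega
        · exact hL'.1 B hB
      · rw [hfst]
        have hr' : rest.Pairwise (· ≤ ·) := by
          have := List.pairwise_map.2 (hL'.2.imp fun h => h.1)
          rw [hrest] at this
          exact (List.pairwise_append.1 this).2.1
        simp only [List.pairwise_append, hpw, hr', pairwise_replicate_le, List.mem_append,
          List.mem_replicate, true_and]
        refine ⟨⟨?_, ?_⟩, ?_⟩
        · rintro a ⟨-, rfl⟩ b hb
          exact (Nat.le_succ _).trans (hr b hb)
        · rintro a ⟨-, rfl⟩ b (⟨-, rfl⟩ | hb)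
          · exact le_rfl
          · exact (Nat.le_succ _).trans (hr b hb)
        · rintro a ha b (⟨-, rfl⟩ | ⟨-, rfl⟩ | hb)
          · exact (hx a ha).le
          · exact (hx a ha).le
          · exact ((hx a ha).le.trans (Nat.le_succ _)).trans (hr b hb)
      · have e2 : M.map Prod.snd = List.replicate p (x + 1) := by
          rw [List.eq_replicate_iff]
          refine ⟨by simp [hMl], fun b hb => ?_⟩
          obtain ⟨B, hB, rfl⟩ := List.mem_map.1 hb
          exact (hMmem B hB).2
        have hL2 : (L'.map Prod.snd).Pairwise (· ≤ ·) :=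
          List.pairwise_map.2 (hL'.2.imp fun h => h.2)
        simp only [List.map_append, e2, List.map_replicate, List.pairwise_append, hL2,
          pairwise_replicate_le, true_and, List.mem_append, List.mem_replicate]
        refine ⟨?_, ?_⟩
        · rintro a ⟨-, rfl⟩ b ⟨-, rfl⟩
          omega
        · rintro a ha b hb'
          obtain ⟨B, hB, rfl⟩ := List.mem_map.1 hb'
          have := hb B hB
          omega
    -- The smaller letters are counted through the list of first coordinates, from which the
    -- singletons are subtracted. Letters still open would otherwise have to be traced through the
    -- later blocks that close them.
    have hmin : ∀ y, x ≤ y → minPairs (List.replicate s (x, x) ++ M ++ L') y =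
        if y = x then q else minPairs L' y := by
      intro y hy
      have h1 := count_map_fst hL y
      have h2 := count_map_fst hL' y
      rw [hcount, hfst] at h1
      rw [hrest] at h2
      have h3 : pend.count y = 0 := List.count_eq_zero.2 fun h => by have := hx y h; omega
      simp only [List.count_append, h3, List.count_replicate, beq_iff_eq] at h1 h2
      generalize minPairs (List.replicate s (x, x) ++ M ++ L') y = N at h1
      split_ifs with hyx
      · subst hyx
        have h4 : rest.count y = 0 := List.count_eq_zero.2 fun h => by have := hr y h; omega
        have h5 := (hcountL' y le_rfl).1
        simp [h4, h5] at h1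
        omega
      · have h4 : (Q.drop p).count y = 0 := List.count_eq_zero.2 fun h => by
          have := hQx y (List.mem_of_mem_drop h); omega
        simp [h4, hyx, Ne.symm hyx] at h1 h2
        omega
    refine ⟨List.replicate s (x, x) ++ M ++ L', hL, ?_, ?_, ⟨_, hfst, ?_⟩, ?_⟩
    · intro B hB
      simp only [List.mem_append] at hB
      rcases hB with (hB | hB) | hB
      · rw [List.eq_of_mem_replicate hB]; simp
      · have := hMmem B hB; omega
      · have := hb B hB; omega
    · intro B hB hBx
      simp only [List.mem_append] at hB
      rcases hB with (hB | hB) | hB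
      · rw [List.eq_of_mem_replicate hB]
      · have := hMmem B hB; omega
      · have := hb B hB; omega
    · intro r hr'
      simp only [List.mem_append, List.mem_replicate] at hr'
      rcases hr' with ⟨-, rfl⟩ | ⟨-, rfl⟩ | hr'
      · exact le_rfl
      · exact le_rfl
      · exact (Nat.le_succ _).trans (hr r hr')
    · rw [runsPath, hmin x le_rfl, hmax, hmaxL', hcount, (hcountL' x le_rfl).1]
      simp only [if_true, Nat.add_zero]
      congr 3
      refine runsPath_congr (fun y hy => ?_) (fun y hy => ?_) (fun y hy => ?_)
      · rw [hcount, if_neg (by omega), zero_add]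
      · rw [hmin y (by omega), if_neg (by omega)]
      · rw [hmax, if_neg (by omega), zero_add]

theorem exists_blocksPath_eq {n k : ℕ} (hk1 : 1 ≤ k) {P : List Step}
    (hP : P ∈ dispersedDyck (n + 2 * (k - 1)) (k - 1)) :
    ∃ L, IsBlocks L ∧ (∀ B ∈ L, 1 ≤ B.1 ∧ B.2 ≤ k) ∧ (blocksWord L).length = n ∧
      blocksPath k L = P := by
  obtain ⟨h1, h2, h3⟩ := hP
  rw [isDispersedDyck_iff] at h2
  have hD : P.head? ≠ some D := by
    intro h0
    cases P with
    | nil => simp at h0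
    | cons c P =>
      obtain rfl : c = D := by simpa using h0
      exact absurd h2.1 (by simp)
  obtain ⟨L, hL, hb, -, ⟨rest, hrest, hr⟩, rfl⟩ := exists_blocks (k - 1) 1 0 [] P h2 hD h3 rfl
    (by simp) (by simp)
  have hk : ∀ B ∈ L, 1 ≤ B.1 ∧ B.2 ≤ k := by
    intro B hB
    refine ⟨hr _ ?_, by have := hb B hB; omega⟩
    rw [List.nil_append] at hrest
    rw [← hrest]
    exact List.mem_map_of_mem hB
  refine ⟨L, hL, hk, ?_, rfl⟩
  have := length_blocksPath hk1 hL hk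
  rw [blocksPath, h1] at this
  omega

/-! ### The bijection and the comparison of statistics -/

theorem bijOn_faroPath (n : ℕ) {k : ℕ} (hk : 1 ≤ k) :
    Set.BijOn (faroPath k) (faroWords n k) (dispersedDyck (n + 2 * (k - 1)) (k - 1)) := by
  refine ⟨?_, ?_, ?_⟩
  · intro w hw
    obtain ⟨L, hL, hLk, rfl, rfl⟩ := mem_faroWords_iff_exists_blocks.1 hw
    rw [faroPath_blocksWord k hL]
    exact blocksPath_mem hk hL hLk
  · intro w hw w' hw' h
    obtain ⟨L, hL, hLk, -, rfl⟩ := mem_faroWords_iff_exists_blocks.1 hw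
    obtain ⟨L', hL', hLk', -, rfl⟩ := mem_faroWords_iff_exists_blocks.1 hw'
    rw [faroPath_blocksWord k hL, faroPath_blocksWord k hL'] at h
    rw [blocksPath_inj hk hL hLk hL' hLk' h]
  · intro P hP
    obtain ⟨L, hL, hLk, hn, rfl⟩ := exists_blocksPath_eq hk hP
    exact ⟨blocksWord L, mem_faroWords_iff_exists_blocks.2 ⟨L, hL, hLk, hn, rfl⟩,
      faroPath_blocksWord k hL⟩

end Faro

open Faro Faro.Step in
theorem theorem4 (n k : ℕ) (hk : 1 ≤ k) :
    Set.BijOn (faroPath k) (faroWords n k) (dispersedDyck (n + 2 * (k - 1)) (k - 1)) ∧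
    ∀ w ∈ faroWords n k, ∀ P : List Step, P = faroPath k w →
      wordStat [1, 1, 1] w = occ [F, F, F] P ∧
      wordStat [1, 1, 2] w =
        plusStat (fun i => occ ([F, F] ++ ud i ++ [F])) P +
        starStat (fun i => occ ([F, F] ++ ud i ++ [U, U])) P ∧
      wordStat [1, 2, 2] w =
        plusStat (fun i => occ ([F] ++ ud i ++ [F, F])) P +
        starStat (fun i => occ ([D, D] ++ ud i ++ [F, F])) P ∧
      wordStat [1, 2, 1] w = occ [F, U, U] P + occ [U, U, U] P ∧
      wordStat [2, 1, 2] w = occ [D, D, F] P + occ [D, D, D] P ∧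
      wordStat [1, 3, 2] w =
        plusStat (fun i => occ ([F] ++ ud i ++ [U, U])) P +
        plusStat (fun i => occ ([U] ++ ud i ++ [U, U])) P +
        starStat (fun i => occ ([D, D] ++ ud i ++ [U, U])) P ∧
      wordStat [2, 1, 3] w =
        plusStat (fun i => occ ([D, D] ++ ud i ++ [F])) P +
        plusStat (fun i => occ ([D, D] ++ ud i ++ [D])) P +
        starStat (fun i => occ ([D, D] ++ ud i ++ [U, U])) P ∧
      wordStat [1, 2, 3] w =
        starStat (fun i => starStat fun j => occ ([D, D] ++ ud i ++ [F] ++ ud j ++ [U, U])) P +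
        starStat (fun i => plusStat fun j => occ ([D, D] ++ ud i ++ [F] ++ ud j ++ [F])) P +
        plusStat (fun i => starStat fun j => occ ([F] ++ ud i ++ [F] ++ ud j ++ [U, U])) P +
        plusStat (fun i => plusStat fun j => occ ([F] ++ ud i ++ [F] ++ ud j ++ [F])) P ∧
      wordStat [2, 1, 1] w = 0 ∧
      wordStat [2, 2, 1] w = 0 ∧
      wordStat [2, 3, 1] w = 0 ∧
      wordStat [3, 1, 2] w = 0 ∧
      wordStat [3, 2, 1] w = 0 := by
  refine ⟨bijOn_faroPath n hk, ?_⟩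
  rintro w hw P rfl
  have hskip := (mem_faroWords.1 hw).2.2
  obtain ⟨L, hL, hLk, -, rfl⟩ := mem_faroWords_iff_exists_blocks.1 hw
  have hV := validFrom_blocksPath hk hL hLk
  have hd := runData_of_isBlocks hL hLk
  -- Every path statistic is brought to the form of a sum over the letters, which is literally the
  -- sum obtained for the word.
  rw [faroPath_blocksWord k hL, pathStat_112 hV, pathStat_122 hV, pathStat_132 hV,
    pathStat_213 hV, pathStat_123 hV, blocksPath, sum_111 hd hk, sum_112 hd hk, sum_122 hd hk,
    sum_132 hd hk, sum_213 hd hk, sum_123 hd hk, sum_FUU hd hk, sum_UUU hd hk, sum_DDF hd hk,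
    sum_DDD hd hk, ← Finset.sum_add_distrib, ← Finset.sum_add_distrib]
  exact ⟨wordStat_111 hL hLk, wordStat_112 hL hLk, wordStat_122 hL hLk, wordStat_121 hL hLk,
    wordStat_212 hL hLk, wordStat_132 hL hLk, wordStat_213 hL hLk, wordStat_123 hL hLk,
    wordStat_eq_zero_of_skipSorted (by simp) hskip, wordStat_eq_zero_of_skipSorted (by simp) hskip,
    wordStat_eq_zero_of_skipSorted (by simp) hskip, wordStat_eq_zero_of_skipSorted (by simp) hskip,
    wordStat_eq_zero_of_skipSorted (by simp) hskip⟩
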